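/- **Corollary (Recursion relation for fusion coefficients).** Let $n,k\ge 1$. Let $P_k^+$ be the set of level-$k$ integral dominant weights $\hat\lambda=\sum_{i\in\mathbb{Z}/n}m_i\hat\omega_i$ of $\widehat{\mathfrak{sl}}(n)$, $m_i\in\mathbb{Z}_{\ge0}$, $\sum_i m_i=k$. Let $\mathfrak{P}_{\le r,c}$ be the set of partitions with at most $r$ rows and $c$ columns, and identify $P_k^+$ with $\mathfrak{P}_{\le n-1,k}$ by sending $\hat\lambda$ to the partition $\lambda$ with exactly $m_i$ columns of length $i$ for $1\le i\le n-1$. For a partition $\lambda$ with at most $n$ rows let $\tilde\lambda$ be $\lambda$ with all columns of length $n$ deleted and, if $\tilde\lambda_1\le k$, let $\hat\lambda\in P_k^+$ be the weight of $\tilde\lambda$; in particular $\widehat{(1^r)}$ is defined for $0\le r\le n$ at every positive level. Write $\varphi_j^*\hat\lambda=\hat\lambda+\hat\omega_j\in P_{k+1}^+$ for $j\in\mathbb{Z}/n$, and let $\hat\nu^*$ be the weight with labels $m_i(\hat\nu^*)=m_{-i}(\hat\nu)$. For partitions $\lambda,\sigma$ with at most $n$ rows put (Kac–Peterson) $$\mathcal{S}^{(k)}_{\lambda\sigma}=\frac{e^{\mathrm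 i\pi n(n-1)/4}}{\sqrt{n(k+n)^{n-1}}}\sum_{w\in S_n}\operatorname{sgn}(w)\,e^{-\frac{2\pi \mathrm i}{k+n}(\bar\sigma+\rho,\,w(\bar\lambda+\rho))},\quad \bar\lambda=\sum_{i=1}^n\Big(\lambda_i-\frac{|\lambda|}{n}\Big)\varepsilon_i,\quad \rho=\sum_{i=1}^n\Big(\frac{n+1}{2}-i\Big)\varepsilon_i,$$ where $(\varepsilon_i,\varepsilon_j)=\delta_{ij}$ and $w$ permutes the $\varepsilon_i$. For a partition $\lambda$ with at most $n$ rows and $\hat\mu,\hat\nu\in P_k^+$ with partitions $\mu,\nu$ let $$\mathcal{V}^{(k)\hat\nu}_{\lambda\hat\mu}=\sum_{\hat\sigma\in P_k^+}\frac{\mathcal{S}^{(k)}_{\lambda\sigma}\mathcal{S}^{(k)}_{\mu\sigma}\mathcal{S}^{(k)}_{\nu^*\sigma}}{\mathcal{S}^{(k)}_{\emptyset\sigma}},$$ with $\nu^*$ the partition of $\hat\nu^*$. The fusion coefficients are $\mathcal{N}^{(k)\hat\nu}_{\hat\lambda\hat\mu}=\mathcal{V}^{(k)\hat\nu}_{\lambda\hat\mu}$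 for $\hat\lambda\in P_k^+$ with partition $\lambda$ (Verlinde formula). Let $\ell\ge0$, $\alpha=(\alpha_1,\dots,\alpha_\ell)$ with integers $0\le\alpha_i\le n$, $\mathbf j=(j_1,\dots,j_\ell)\in(\mathbb{Z}/n)^\ell$ and $\hat\mu,\hat\nu\in P_k^+$. For a sequence $S=(\hat\nu=\hat\mu^{(0)},\hat\mu^{(1)},\dots,\hat\mu^{(\ell)}=\hat\mu)$ in $P_k^+$ set $$\mathcal{N}'_i(S,\mathbf j)=\mathcal{N}^{(k+1)\,\varphi^*_{j_i}\hat\mu^{(i-1)}}_{\widehat{(1^{\alpha_i})}\;\varphi^*_{j_i}\hat\mu^{(i)}},\qquad 1\le i\le\ell .$$ Let $K_{\lambda^t\alpha}$ be the Kostka number, i.e. the number of semistandard tableaux of weight $\alpha$ whose shape is the transpose $\lambda^t$ of $\lambda$. 1. If $\ell\le k+1$, then $$\sum_{S}\mathcal{N}'_1(S,\mathbf j)\cdots\mathcal{N}'_\ell(S,\mathbf j)=\sum_{\lambda\in\mathfrak{P}_{\le n,\ell},\ \tilde\lambda_1\le k}K_{\lambda^t\alpha}\,\mathcal{N}^{(k)\hat\nu}_{\hat\lambda\hat\mu},$$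 the left sum being over all sequences $S$ as above. (If $\ell\le k$, the condition $\tilde\lambda_1\le k$ holds for all $\lambda\in\mathfrak{P}_{\le n,\ell}$.) 2. For every $\ell\ge 0$, $$\sum_{S}\mathcal{N}'_1(S,\mathbf j)\cdots\mathcal{N}'_\ell(S,\mathbf j)=\sum_{\lambda\in\mathfrak{P}_{\le n,\ell}}K_{\lambda^t\alpha}\,\mathcal{V}^{(k)\hat\nu}_{\tilde\lambda\hat\mu}.$$ 3. In particular, for all $0\le r\le n$, $j\in\mathbb{Z}/n$ and $\hat\mu,\hat\nu\in P_k^+$, $$\mathcal{N}^{(k+1)\,\varphi_j^*\hat\nu}_{\widehat{(1^r)}\;\varphi_j^*\hat\mu}=\mathcal{N}^{(k)\,\hat\nu}_{\widehat{(1^r)}\;\hat\mu}.$$ -/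

import Mathlib

namespace SlFusion

open Finset

/-- `P_k^+`: the integral dominant weights `∑ i, m i • ω̂_i` of level `k` of affine `sl(n)`, given by
their Dynkin labels `m i`, where the node `i` of the affine Dynkin diagram runs over `ℤ/n`. -/
abbrev AffineWeight (n k : ℕ) [NeZero n] : Type :=
  {m : ZMod n → ℕ // ∑ i, m i = k}

instance (n k : ℕ) [NeZero n] : Fintype (AffineWeight n k) :=
  Fintype.subtype (Finset.piAntidiag Finset.univ k) (by simp)

/-- The partitions with at most `n` rows and at most `c` columns; `lam i` is the length of the row
with number `i + 1`. -/
abbrev BoxPartition (n c : ℕ) : Type :=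
  {lam : Fin n → ℕ // Antitone lam ∧ ∀ i, lam i ≤ c}

noncomputable instance (n c : ℕ) : Fintype (BoxPartition n c) := by
  classical
  exact Fintype.subtype
    ((Fintype.piFinset fun _ : Fin n => Finset.range (c + 1)).filter fun lam => Antitone lam)
    (by intro lam; simp [and_comm])

/-- Delete all columns of length `n` of a partition with at most `n` rows
(`Fin.rev 0` is the last row). -/
def removeColumns {n : ℕ} [NeZero n] (lam : Fin n → ℕ) : Fin n → ℕ :=
  fun i => lam i - lam (Fin.rev 0)

/-- The partition `(1^r)`, a single column of length `r`, for `r ≤ n`. -/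
def column (n r : ℕ) : Fin n → ℕ :=
  fun i => if (i : ℕ) < r then 1 else 0

theorem column_antitone (n r : ℕ) : Antitone (column n r) := by
  intro i j hij
  have h : (i : ℕ) ≤ (j : ℕ) := hij
  unfold column
  split_ifs <;> omega

theorem column_le (n r : ℕ) (i : Fin n) : column n r i ≤ 1 := by
  unfold column
  split_ifs <;> omega

namespace AffineWeight

variable {n k : ℕ} [NeZero n]

/-- The partition of a dominant weight: it has exactly `m i` columns of length `i`, `0 < i < n`.
(So its last row is zero.) -/
def toPartition (w : AffineWeight n k) : Fin n → ℕ :=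
  fun i => ∑ j : ZMod n with (i : ℕ) < j.val, w.1 j

/-- The Dynkin labels of the level `k` weight whose partition is `removeColumns lam`:
`m i = lam_i - lam_{i+1}` for `0 < i < n`, and `m 0 = k - (lam_1 - lam_n)`. -/
def labels (k : ℕ) (lam : Fin n → ℕ) : ZMod n → ℕ :=
  fun i =>
    if i = 0 then k - removeColumns lam 0
    else lam ⟨i.val - 1, (Nat.sub_le _ _).trans_lt i.val_lt⟩ - lam ⟨i.val, i.val_lt⟩

theorem sum_labels (lam : Fin n → ℕ) (hlam : Antitone lam) (hk : removeColumns lam 0 ≤ k) :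
    ∑ i, labels k lam i = k := by
  obtain _ | n := n
  · exact absurd rfl (NeZero.ne 0)
  have key : ∀ (N : ℕ) (g : Fin (N + 1) → ℕ), Antitone g →
      ∑ i : Fin N, (g i.castSucc - g i.succ) = g 0 - g (Fin.last N) := by
    intro N
    induction N with
    | zero => intro g _; simp
    | succ N ih =>
      intro g hg
      rw [Fin.sum_univ_castSucc]
      have h1 := ih (fun i => g i.castSucc) (fun a b hab => hg (by simpa using hab))
      simp only [Fin.succ_castSucc] at *
      rw [h1]
      have h2 : g (Fin.last N).castSucc ≤ g (Fin.castSucc 0) := hg (Fin.zero_le _)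
      have h3 : g (Fin.last N).succ ≤ g (Fin.last N).castSucc :=
        hg (Fin.castSucc_lt_succ).le
      have e : (Fin.last N).succ = Fin.last (N + 1) := rfl
      rw [Fin.castSucc_zero] at h2 ⊢
      rw [e] at h3 ⊢
      omega
  have h0 : ∑ i : ZMod (n + 1), labels k lam i
      = labels k lam 0 + ∑ i : Fin n, (lam i.castSucc - lam i.succ) := by
    refine (Fin.sum_univ_succ (n := n) (labels k lam : Fin (n + 1) → ℕ)).trans ?_
    rfl
  rw [h0, key n lam hlam]
  have : Fin.rev (0 : Fin (n + 1)) = Fin.last n := by simp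
  simp only [labels, removeColumns, if_true, this] at *
  omega

/-- `λ̂ ∈ P_k^+`: delete the columns of length `n` of a partition with at most `n` rows, and take the
preimage under `toPartition`. It exists if at most `k` columns are left. -/
def ofPartition (lam : Fin n → ℕ) (hlam : Antitone lam) (hk : removeColumns lam 0 ≤ k) :
    AffineWeight n k :=
  ⟨labels k lam, sum_labels lam hlam hk⟩

/-- The weight of the one-column partition `(1^r)` at a positive level. -/
def ofColumn (r : ℕ) (hk : 1 ≤ k) : AffineWeight n k :=
  ofPartition (column n r) (column_antitone n r)
    (((Nat.sub_le _ _).trans (column_le n r 0)).trans hk)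

/-- The creation operator `φ_j^*` on dominant weights, `λ̂ ↦ λ̂ + ω̂_j`. -/
def create (j : ZMod n) (w : AffineWeight n k) : AffineWeight n (k + 1) :=
  ⟨w.1 + Pi.single j 1, by simp [Finset.sum_add_distrib, w.2]⟩

/-- Charge conjugation: the diagram automorphism that fixes the node `0` and exchanges the nodes
`i` and `n - i`. -/
def conj (w : AffineWeight n k) : AffineWeight n k :=
  ⟨fun i => w.1 (-i), (Fintype.sum_equiv (Equiv.neg (ZMod n)) _ w.1 fun _ => rfl).trans w.2⟩

end AffineWeight

/-- Coordinates with respect to `ε_1, …, ε_n` of the finite weight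
`∑ i, (lam_i - |lam| / n) ε_i` of a partition. -/
noncomputable def finiteWeight {n : ℕ} (lam : Fin n → ℕ) : Fin n → ℝ :=
  fun i => (lam i : ℝ) - (∑ j, (lam j : ℝ)) / n

/-- The Weyl vector `∑ i, ((n + 1) / 2 - i) ε_i` (with `i` counted from one). -/
noncomputable def weylVector (n : ℕ) : Fin n → ℝ :=
  fun i => ((n : ℝ) + 1) / 2 - ((i : ℝ) + 1)

/-- The modular `S`-matrix of level `k`, by the Kac–Peterson formula
`e^{iπn(n-1)/4} / √(n(k+n)^{n-1}) · ∑_{w ∈ S_n} sgn(w) e^{-2πi (σ+ρ, w(λ+ρ)) / (k+n)}`. -/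
noncomputable def modularS {n : ℕ} (k : ℕ) (lam sig : Fin n → ℕ) : ℂ :=
  Complex.exp (Complex.I * Real.pi * (n * (n - 1)) / 4)
      / (Real.sqrt (n * ((k : ℝ) + n) ^ (n - 1)) : ℝ)
    * ∑ w : Equiv.Perm (Fin n), (Equiv.Perm.sign w : ℤ)
        * Complex.exp (-(2 * Real.pi * Complex.I / (k + n))
            * (∑ i, (finiteWeight sig i + weylVector n i)
                * (finiteWeight lam (w⁻¹ i) + weylVector n (w⁻¹ i)) : ℝ))

/-- The right-hand side of the Verlinde formula of level `k`, where the first weight is given by a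
partition, which need not belong to a weight of level `k`. -/
noncomputable def verlindeSum {n k : ℕ} [NeZero n] (lam : Fin n → ℕ)
    (mu nu : AffineWeight n k) : ℂ :=
  ∑ sig : AffineWeight n k,
    modularS k lam sig.toPartition * modularS k mu.toPartition sig.toPartition
        * modularS k nu.conj.toPartition sig.toPartition
      / modularS k (fun _ => 0) sig.toPartition

/-- The fusion coefficient `N_{λ̂ μ̂}^{(k) ν̂}`, by the Verlinde formula. -/
noncomputable def fusionCoeff {n k : ℕ} [NeZero n] (lam mu nu : AffineWeight n k) : ℂ :=
  verlindeSum lam.toPartition mu nu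

/-- The Young diagram of a partition. -/
def youngDiagram {n : ℕ} (lam : Fin n → ℕ) (hlam : Antitone lam) : YoungDiagram :=
  YoungDiagram.ofRowLens (List.ofFn lam) (List.sortedGE_ofFn_iff.mpr hlam)

/-- The Kostka number: the number of semistandard tableaux of the given shape with `α_i` entries
equal to `i` for `i < l`, and no other entries. -/
noncomputable def kostka {l : ℕ} (shape : YoungDiagram) (α : Fin l → ℕ) : ℕ :=
  Nat.card {T : SemistandardYoungTableau shape //
    ∀ i : ℕ, (shape.cells.filter fun c => T c.1 c.2 = i).card = if h : i < l then α ⟨i, h⟩ else 0}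

end SlFusion

/-! By the Kac–Peterson formula, `modularS k λ σ` is a constant times the alternant with exponents λ
+ ρ, up to a common shift, at a torus point `σ.point` whose coordinates have product one and equal
(k+n)-th powers (`modularS_eq`). Dividing by the value for ∅ gives the Schur polynomial s_λ at that
point; for (1^r) it is the elementary symmetric polynomial e_r.

Multiplying an alternant by e_r raises r exponents by one. From the interior of the alcove this
leads at most onto a wall, where the alternant vanishes, so e_r acts on the S-matrix by hops between
weights of level k (`elementarySymm_mul_modularS`). Orthogonality then identifies the fusion
coefficients of a column with hop counts (`fusionCoeff_ofColumn`). Adding ω̂_j to both weights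
translates both exponent vectors equally, so hop counts do not see the passage from level k to k+1
(`hopCount_create`). This is the single-column case.

The path sum therefore equals ∑_σ ∏ e_{α_i}(σ.point) S_{μσ} S_{ν*σ}. Expanding e_α = ∑ K_{λ^t α} s_λ
by iterated Pieri (`prod_elementarySymm_mul_alternant`, `kostka_transpose`) yields the Verlinde
sums. If l ≤ k+1, the only partitions without a weight of level k have λ̃_1 = k+1; they lie on the
affine wall and contribute zero (`verlindeSum_eq_zero`). -/

namespace SlFusion

open Finset

/-! ### Alternants and multiplication by elementary symmetric polynomials -/

section Alternant

variable {n : ℕ}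

/-- The alternant `det (x_i ^ b_j)` with integer exponents. -/
noncomputable def alternant (x : Fin n → ℂ) (b : Fin n → ℤ) : ℂ :=
  ∑ w : Equiv.Perm (Fin n), ((Equiv.Perm.sign w : ℤ) : ℂ) * ∏ i, x (w i) ^ b i

theorem alternant_eq_det (x : Fin n → ℂ) (b : Fin n → ℤ) :
    alternant x b = (Matrix.of fun i j => x i ^ b j).det := by
  rw [Matrix.det_apply']; rfl

theorem alternant_eq_zero_of_eq {x : Fin n → ℂ} {i j : Fin n} (hij : i ≠ j) (h : x i = x j)
    (b : Fin n → ℤ) : alternant x b = 0 := by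
  rw [alternant_eq_det]
  exact Matrix.det_zero_of_row_eq hij (by ext p; simp [h])

/-- Columns i and j of the matrix are proportional. The case `c = 1` covers the finite walls, the
case of a common N-th power of the coordinates the affine wall. -/
theorem alternant_eq_zero_of_proportional {x : Fin n → ℂ} {b : Fin n → ℤ} {i j : Fin n}
    (hij : i ≠ j) (c : ℂ) (h : ∀ p, x p ^ b i = c * x p ^ b j) : alternant x b = 0 := by
  rw [alternant_eq_det, ← Matrix.exists_mulVec_eq_zero_iff]
  refine ⟨Pi.single i 1 - Pi.single j c, fun h0 => ?_, ?_⟩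
  · have := congrFun h0 i
    simp [hij] at this
  · ext p
    simp [Matrix.mulVec_sub, Matrix.mulVec_single, h p]

/-- The shift multiplies each term by a power of ∏ x_i = 1. This is why columns of length n do not
matter. -/
theorem alternant_add_const {x : Fin n → ℂ} (hx : ∀ i, x i ≠ 0) (hp : ∏ i, x i = 1)
    (b : Fin n → ℤ) (c : ℤ) : alternant x (fun i => b i + c) = alternant x b := by
  unfold alternant
  refine Finset.sum_congr rfl fun w _ => ?_
  congr 1
  simp_rw [zpow_add₀ (hx _), Finset.prod_mul_distrib, Finset.prod_zpow]
  rw [Equiv.prod_comp w x, hp, one_zpow, mul_one]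

theorem alternant_comp_left (x : Fin n → ℂ) (b : Fin n → ℤ) (w : Equiv.Perm (Fin n)) :
    alternant (x ∘ w) b = ((Equiv.Perm.sign w : ℤ) : ℂ) * alternant x b := by
  rw [alternant_eq_det, alternant_eq_det]
  exact Matrix.det_permute w (Matrix.of fun i j => x i ^ b j)

theorem alternant_comp_right (x : Fin n → ℂ) (b : Fin n → ℤ) (w : Equiv.Perm (Fin n)) :
    alternant x (b ∘ w) = ((Equiv.Perm.sign w : ℤ) : ℂ) * alternant x b := by
  rw [alternant_eq_det, alternant_eq_det]
  exact Matrix.det_permute' w (Matrix.of fun i j => x i ^ b j)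

/-- The elementary symmetric polynomial of degree `r` at the point `x`. -/
noncomputable def elementarySymm (r : ℕ) (x : Fin n → ℂ) : ℂ :=
  ∑ I ∈ powersetCard r univ, ∏ i ∈ I, x i

/-- The exponent vector `b` raised by one at the places in `I`. -/
def raise (b : Fin n → ℤ) (I : Finset (Fin n)) : Fin n → ℤ :=
  fun i => b i + if i ∈ I then 1 else 0

theorem elementarySymm_comp (r : ℕ) (x : Fin n → ℂ) (w : Equiv.Perm (Fin n)) :
    elementarySymm r (x ∘ w) = elementarySymm r x := by
  unfold elementarySymm
  conv_rhs => rw [← Finset.map_univ_equiv w, Finset.powersetCard_map]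
  simp

/-- Since e_r is symmetric, it may be evaluated at `x ∘ w` in the term of w, where each of its
monomials raises r exponents. -/
theorem elementarySymm_mul_alternant (r : ℕ) {x : Fin n → ℂ} (hx : ∀ i, x i ≠ 0)
    (b : Fin n → ℤ) : elementarySymm r x * alternant x b
      = ∑ I ∈ powersetCard r univ, alternant x (raise b I) := by
  unfold alternant
  rw [Finset.sum_comm, Finset.mul_sum]
  refine Finset.sum_congr rfl fun w _ => ?_
  rw [← elementarySymm_comp r x w, elementarySymm, Finset.sum_mul]
  refine Finset.sum_congr rfl fun I _ => ?_
  have : ∏ i, x (w i) ^ raise b I i = (∏ i, x (w i) ^ b i) * ∏ i ∈ I, x (w i) := by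
    simp only [raise]
    simp_rw [zpow_add₀ (hx _), Finset.prod_mul_distrib]
    congr 1
    simp
  rw [this]
  simp only [Function.comp]
  ring

/-- Moving the permutations from the variables to the exponents writes the product as a combination
of characters, ready for their orthogonality. -/
theorem alternant_mul_alternant (x : Fin n → ℂ) (hx : ∀ i, x i ≠ 0) (a b : Fin n → ℤ) :
    alternant x a * alternant x b = ∑ v : Equiv.Perm (Fin n), ∑ w : Equiv.Perm (Fin n),
      ((Equiv.Perm.sign v : ℤ) : ℂ) * ((Equiv.Perm.sign w : ℤ) : ℂ) *
        ∏ i, x i ^ (a (v i) + b (w i)) := by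
  have key : ∀ c : Fin n → ℤ, alternant x c
      = ∑ w : Equiv.Perm (Fin n), ((Equiv.Perm.sign w : ℤ) : ℂ) * ∏ i, x i ^ c (w i) := by
    intro c
    unfold alternant
    refine (Equiv.sum_comp (Equiv.inv (Equiv.Perm (Fin n))) _).symm.trans ?_
    refine Finset.sum_congr rfl fun w _ => ?_
    simp only [Equiv.inv_apply, Equiv.Perm.sign_inv]
    congr 1
    rw [← Equiv.prod_comp w]
    simp
  rw [key, key, Finset.sum_mul_sum]
  refine Finset.sum_congr rfl fun v _ => Finset.sum_congr rfl fun w _ => ?_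
  simp_rw [zpow_add₀ (hx _), Finset.prod_mul_distrib]
  ring

end Alternant

/-! ### A finite group of torus points and orthogonality of its characters -/

section Torus

variable {n : ℕ}

/-- The primitive root of unity `exp (-2πi / (n N))`. -/
noncomputable def torusRoot (n N : ℕ) : ℂ :=
  (Complex.exp (2 * Real.pi * Complex.I / ((n * N : ℕ) : ℂ)))⁻¹

theorem torusRoot_isPrimitiveRoot (n N : ℕ) [NeZero n] [NeZero N] :
    IsPrimitiveRoot (torusRoot n N) (n * N) :=
  (Complex.isPrimitiveRoot_exp (n * N) (NeZero.ne _)).inv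

theorem torusRoot_ne_zero (n N : ℕ) : torusRoot n N ≠ 0 :=
  inv_ne_zero (Complex.exp_ne_zero _)

theorem torusRoot_zpow_eq_one_iff (n N : ℕ) [NeZero n] [NeZero N] (z : ℤ) :
    torusRoot n N ^ z = 1 ↔ (n * N : ℤ) ∣ z := by
  rw [(torusRoot_isPrimitiveRoot n N).zpow_eq_one_iff_dvd]
  push_cast
  rfl

/-- The point of the torus with coordinates `exp (-2πi (s_i - mean s) / N)`. -/
noncomputable def torusPoint (N : ℕ) (s : Fin n → ℤ) : Fin n → ℂ :=
  fun i => torusRoot n N ^ (n * s i - ∑ j, s j)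

theorem torusPoint_ne_zero (N : ℕ) (s : Fin n → ℤ) (i : Fin n) : torusPoint N s i ≠ 0 :=
  zpow_ne_zero _ (torusRoot_ne_zero n N)

/-- The pairing is symmetric, so the centring can be moved from s to e. The coordinates of s then
separate, and sums over boxes factorize. -/
theorem prod_torusPoint_zpow (N : ℕ) (s e : Fin n → ℤ) :
    ∏ i, torusPoint N s i ^ e i = ∏ i, torusRoot n N ^ (s i * (n * e i - ∑ j, e j)) := by
  have h : ∀ f : Fin n → ℤ, ∏ i, torusRoot n N ^ f i = torusRoot n N ^ ∑ i, f i := by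
    intro f
    induction (univ : Finset (Fin n)) using Finset.induction_on with
    | empty => simp
    | insert a t ha ih => rw [prod_insert ha, sum_insert ha, zpow_add₀ (torusRoot_ne_zero n N), ih]
  simp only [torusPoint, ← zpow_mul]
  rw [h, h]
  congr 1
  simp only [sub_mul, mul_sub, Finset.sum_sub_distrib, ← Finset.sum_mul, ← Finset.mul_sum]
  congr 1
  exact Finset.sum_congr rfl fun i _ => by ring

theorem prod_torusPoint (N : ℕ) (s : Fin n → ℤ) : ∏ i, torusPoint N s i = 1 := by
  have := prod_torusPoint_zpow N s (fun _ => 1)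
  simpa using this

theorem torusPoint_comp (N : ℕ) (s : Fin n → ℤ) (w : Equiv.Perm (Fin n)) :
    torusPoint N (s ∘ w) = torusPoint N s ∘ w := by
  ext i
  simp only [torusPoint, Function.comp]
  rw [Equiv.sum_comp w s]

/-- The lattice of exponent vectors whose character is trivial on all torus points. -/
def InLattice (N : ℕ) (e : Fin n → ℤ) : Prop := ∀ i, (n * N : ℤ) ∣ n * e i - ∑ j, e j

/-- By the symmetry of the pairing, the lattice of trivial characters is also the lattice of periods
of `torusPoint N`. -/
theorem torusPoint_eq_iff [NeZero n] (N : ℕ) [NeZero N] (s t : Fin n → ℤ) :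
    torusPoint N s = torusPoint N t ↔ InLattice N (fun i => s i - t i) := by
  rw [funext_iff]
  refine forall_congr' fun i => ?_
  rw [← torusRoot_zpow_eq_one_iff, ← div_eq_one_iff_eq (torusPoint_ne_zero N t i), torusPoint,
    torusPoint, ← zpow_sub₀ (torusRoot_ne_zero n N), Finset.sum_sub_distrib]
  congr! 2
  ring

theorem torusPoint_apply_eq_iff [NeZero n] (N : ℕ) [NeZero N] (s : Fin n → ℤ) (i j : Fin n) :
    torusPoint N s i = torusPoint N s j ↔ (N : ℤ) ∣ s i - s j := by
  rw [← div_eq_one_iff_eq (torusPoint_ne_zero N s j), torusPoint,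
    torusPoint, ← zpow_sub₀ (torusRoot_ne_zero n N), torusRoot_zpow_eq_one_iff,
    show (n * s i - ∑ j, s j - (n * s j - ∑ j, s j) : ℤ) = n * (s i - s j) by ring]
  exact mul_dvd_mul_iff_left (by exact_mod_cast NeZero.ne n)

theorem torusPoint_zpow_level [NeZero n] (N : ℕ) [NeZero N] (s : Fin n → ℤ) (i : Fin n) :
    torusPoint N s i ^ (N : ℤ) = torusRoot n N ^ (-(N * ∑ j, s j) : ℤ) := by
  rw [torusPoint, ← zpow_mul, ← div_eq_one_iff_eq (zpow_ne_zero _ (torusRoot_ne_zero n N)),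
    ← zpow_sub₀ (torusRoot_ne_zero n N), torusRoot_zpow_eq_one_iff]
  exact ⟨s i, by ring⟩

/-- The lattice is spanned by (1, …, 1) and N times the root lattice, the translations of the affine
Weyl group. -/
theorem inLattice_iff [NeZero n] (N : ℕ) (e : Fin n → ℤ) [NeZero N] :
    InLattice N e ↔ ∃ (d : ℤ) (q : Fin n → ℤ), ∑ i, q i = 0 ∧ ∀ i, e i = d + N * q i := by
  have hn : (n : ℤ) ≠ 0 := by exact_mod_cast NeZero.ne n
  have hN : (N : ℤ) ≠ 0 := by exact_mod_cast NeZero.ne N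
  constructor
  · intro h
    have h1 : ∀ i, ∃ r, e i = e 0 + N * r := by
      intro i
      have h2 := dvd_sub (h i) (h 0)
      rw [show (n * e i - ∑ j, e j - (n * e 0 - ∑ j, e j) : ℤ) = n * (e i - e 0) by ring] at h2
      obtain ⟨r, hr⟩ := (mul_dvd_mul_iff_left hn).1 h2
      exact ⟨r, by linarith⟩
    choose r hr using h1
    have hs : ∑ j, e j = n * e 0 + N * ∑ j, r j := by
      rw [Finset.sum_congr rfl fun i _ => hr i]
      simp [Finset.sum_add_distrib, Finset.mul_sum]
    have h3 := h 0
    rw [hs, show (n * e 0 - (n * e 0 + N * ∑ j, r j) : ℤ) = N * (-∑ j, r j) by ring,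
      mul_comm (n : ℤ), mul_dvd_mul_iff_left hN] at h3
    obtain ⟨c, hc⟩ := (dvd_neg.1 h3)
    -- Here `∑ r = n * c`, so subtracting c from each `r i` makes the sum zero, and the constant
    -- absorbs `N * c`.
    refine ⟨e 0 + N * c, fun i => r i - c, ?_, fun i => ?_⟩
    · simp [Finset.sum_sub_distrib, hc]
    · rw [hr i]; ring
  · rintro ⟨d, q, hq, h⟩ i
    have hs : ∑ j, e j = n * d := by
      rw [Finset.sum_congr rfl fun i _ => h i]
      simp [Finset.sum_add_distrib, ← Finset.mul_sum, hq]
    rw [hs, h i]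
    exact ⟨q i, by ring⟩

/-- The number of values of the coordinate `i` of the points in `fundamentalBox`. -/
def boxCount (n N : ℕ) [NeZero n] (i : Fin n) : ℕ := if i = 0 then n else N

/-- The step between the values of the coordinate `i` of the points in `fundamentalBox`. -/
def boxStep (n N : ℕ) [NeZero n] (i : Fin n) : ℕ := if i = 0 then N else 1

/-- A set of representatives of the integer vectors modulo the lattice `InLattice N`. -/
def fundamentalBox (n N : ℕ) [NeZero n] : Finset (Fin n → ℤ) :=
  Fintype.piFinset fun i =>
    (range (boxCount n N i)).image fun p : ℕ => (boxStep n N i * p : ℤ)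

theorem sum_pow_eq_zero_of_pow_eq_one {z : ℂ} {c : ℕ} (hc : z ^ c = 1) (hz : z ≠ 1) :
    ∑ p ∈ range c, z ^ p = 0 := by
  rw [geom_sum_eq hz, hc, sub_self, zero_div]

/-- The sum factorizes into geometric sums, one for each coordinate. -/
theorem sum_fundamentalBox [NeZero n] (N : ℕ) [NeZero N] (e : Fin n → ℤ)
    [Decidable (InLattice N e)] :
    ∑ d ∈ fundamentalBox n N, ∏ i, torusPoint N d i ^ e i
      = if InLattice N e then (n * N ^ (n - 1) : ℂ) else 0 := by
  have hn : (n : ℤ) ≠ 0 := by exact_mod_cast NeZero.ne n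
  have hN : (N : ℤ) ≠ 0 := by exact_mod_cast NeZero.ne N
  set u : Fin n → ℤ := fun i => n * e i - ∑ j, e j with hu
  have hsum : ∑ d ∈ fundamentalBox n N, ∏ i, torusPoint N d i ^ e i
      = ∏ i, ∑ p ∈ range (boxCount n N i), (torusRoot n N ^ (boxStep n N i * u i : ℤ)) ^ p := by
    simp_rw [prod_torusPoint_zpow]
    rw [fundamentalBox, ← Finset.prod_univ_sum (fun i =>
      (range (boxCount n N i)).image fun p : ℕ => (boxStep n N i * p : ℤ))
      (fun i z => torusRoot n N ^ (z * (n * e i - ∑ j, e j)))]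
    refine Finset.prod_congr rfl fun i _ => ?_
    rw [Finset.sum_image]
    · refine Finset.sum_congr rfl fun p _ => ?_
      rw [← zpow_natCast, ← zpow_mul]
      congr 1
      simp only [hu]
      ring
    · intro p _ q _ hpq
      have : (boxStep n N i : ℤ) ≠ 0 := by
        unfold boxStep; split_ifs <;> simp [NeZero.ne N]
      exact_mod_cast mul_left_cancel₀ this hpq
  rw [hsum]
  split_ifs with h
  · have : ∀ i, ∑ p ∈ range (boxCount n N i), (torusRoot n N ^ (boxStep n N i * u i : ℤ)) ^ p
        = boxCount n N i := by
      intro i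
      rw [(torusRoot_zpow_eq_one_iff n N _).2 ((h i).mul_left _)]
      simp
    simp_rw [this]
    rw [← Finset.mul_prod_erase univ _ (mem_univ (0 : Fin n))]
    rw [show boxCount n N 0 = n from if_pos rfl]
    congr 1
    · rw [Finset.prod_congr rfl (g := fun _ => (N : ℂ))]
      · simp
      · intro i hi
        simp [boxCount, Finset.ne_of_mem_erase hi]
  -- If n does not divide `∑ e`, the factor of coordinate 0 vanishes. Otherwise all `u i` are
  -- multiples of n; as they sum to zero, failure of the lattice condition shows at some i ≠ 0,
  -- whose factor vanishes.
  · by_cases hd : (n : ℤ) ∣ ∑ j, e j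
    · obtain ⟨d, hd⟩ := hd
      have hud : ∀ i, u i = n * (e i - d) := fun i => by simp only [hu, hd]; ring
      have hex : ∃ i, i ≠ 0 ∧ ¬ (n * N : ℤ) ∣ u i := by
        by_contra hcon
        push Not at hcon
        refine h fun i => ?_
        by_cases hi : i = 0
        · have h0 : ∑ i, u i = 0 := by
            simp [hu, Finset.sum_sub_distrib, ← Finset.mul_sum]
          rw [← Finset.add_sum_erase univ _ (mem_univ i)] at h0
          have h2 : u i = -∑ x ∈ univ.erase i, u x := by linarith
          change _ ∣ u i
          rw [h2, dvd_neg]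
          exact Finset.dvd_sum fun x hx => hcon x (hi ▸ Finset.ne_of_mem_erase hx)
        · exact hcon i hi
      obtain ⟨i, hi, hdi⟩ := hex
      refine Finset.prod_eq_zero (mem_univ i) (sum_pow_eq_zero_of_pow_eq_one ?_ ?_)
      · rw [← zpow_natCast, ← zpow_mul, torusRoot_zpow_eq_one_iff]
        exact ⟨e i - d, by simp only [boxStep, boxCount, hi, if_false, hud]; push_cast; ring⟩
      · rw [Ne, torusRoot_zpow_eq_one_iff]
        simpa [boxStep, hi] using hdi
    · refine Finset.prod_eq_zero (mem_univ 0) (sum_pow_eq_zero_of_pow_eq_one ?_ ?_)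
      · rw [← zpow_natCast, ← zpow_mul, torusRoot_zpow_eq_one_iff]
        exact ⟨u 0, by simp only [boxStep, boxCount, if_true]; ring⟩
      · rw [Ne, torusRoot_zpow_eq_one_iff]
        simp only [boxStep, if_true]
        rw [mul_comm (n : ℤ), mul_dvd_mul_iff_left hN]
        simp only [hu]
        rwa [dvd_sub_right (dvd_mul_right _ _)]

theorem torusPoint_injOn_fundamentalBox [NeZero n] (N : ℕ) [NeZero N] :
    Set.InjOn (torusPoint N) (fundamentalBox n N : Set (Fin n → ℤ)) := by
  intro d hd t ht h
  have hn : (n : ℤ) ≠ 0 := by exact_mod_cast NeZero.ne n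
  have hN : (0 : ℤ) < N := by exact_mod_cast NeZero.pos N
  rw [torusPoint_eq_iff] at h
  simp only [fundamentalBox, mem_coe, Fintype.mem_piFinset, mem_image, mem_range] at hd ht
  obtain ⟨p, hp, hdp⟩ := hd 0
  obtain ⟨p', hp', htp⟩ := ht 0
  simp only [boxStep, boxCount, if_true] at hp hp' hdp htp
  obtain ⟨c, q, hq, he⟩ := (inLattice_iff N _).1 h
  have hi : ∀ i, i ≠ 0 → d i - t i = 0 := by
    intro i hi
    obtain ⟨r, hr, hdr⟩ := hd i
    obtain ⟨r', hr', htr⟩ := ht i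
    simp only [boxStep, boxCount, hi, if_false] at hr hr' hdr htr
    have h1 : (N : ℤ) ∣ d i - t i := by
      have : d i - t i = N * (p - p' + q i - q 0) := by
        have := he i; have := he 0; simp only [← hdp, ← htp] at *; linarith
      exact ⟨_, this⟩
    refine Int.eq_zero_of_abs_lt_dvd h1 ?_
    rw [abs_lt]
    push_cast at hdr htr
    constructor <;> omega
  -- The sum of the differences is now `d 0 - t 0`, so the lattice condition at index 0 forces n to
  -- divide `p - p'`.
  have h0 : d 0 - t 0 = 0 := by
    have hs : ∑ i, (d i - t i) = d 0 - t 0 :=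
      Finset.sum_eq_single 0 (fun i _ h => hi i h) (by simp)
    have h1 := h 0
    rw [hs] at h1
    have h2 : (n * N : ℤ) ∣ n * (d 0 - t 0) := ⟨p - p', by rw [← hdp, ← htp]; ring⟩
    have h3 := (dvd_sub_right h2).1 h1
    rw [← hdp, ← htp, ← mul_sub, mul_comm (n : ℤ), mul_dvd_mul_iff_left hN.ne'] at h3
    have h4 := Int.eq_zero_of_abs_lt_dvd h3 (by rw [abs_lt]; constructor <;> omega)
    rw [← hdp, ← htp, ← mul_sub, h4, mul_zero]
  ext i
  by_cases h : i = 0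
  · subst h; linarith
  · linarith [hi i h]

theorem exists_mem_fundamentalBox [NeZero n] (N : ℕ) [NeZero N] (s : Fin n → ℤ) :
    ∃ d ∈ fundamentalBox n N, torusPoint N d = torusPoint N s := by
  have hn : (0 : ℤ) < n := by exact_mod_cast NeZero.pos n
  have hN : (0 : ℤ) < N := by exact_mod_cast NeZero.pos N
  -- Reducing the coordinates modulo N costs Q translations in total. Lattice translations need
  -- total zero, so coordinate 0 carries the excess, which matters only modulo n.
  set Q : ℤ := ∑ i, (s i - s 0) / N with hQ
  refine ⟨fun i => if i = 0 then N * (Q % n) else (s i - s 0) % N, ?_, ?_⟩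
  · simp only [fundamentalBox, Fintype.mem_piFinset, mem_image, mem_range]
    intro i
    by_cases hi : i = 0
    · refine ⟨(Q % n).toNat, ?_, ?_⟩
      · have := Int.emod_lt_of_pos Q hn
        have := Int.emod_nonneg Q hn.ne'
        simp only [boxCount, hi, if_true]; omega
      · simp [boxStep, hi, Int.toNat_of_nonneg (Int.emod_nonneg Q hn.ne')]
    · refine ⟨((s i - s 0) % N).toNat, ?_, ?_⟩
      · have := Int.emod_lt_of_pos (s i - s 0) hN
        have := Int.emod_nonneg (s i - s 0) hN.ne'
        simp only [boxCount, hi, if_false]; omega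
      · simp [boxStep, hi, Int.toNat_of_nonneg (Int.emod_nonneg (s i - s 0) hN.ne')]
  · symm
    rw [torusPoint_eq_iff, inLattice_iff]
    refine ⟨s 0 + N * (Q / n), fun i => (s i - s 0) / N - Q / n
      - if i = 0 then Q % n else 0, ?_, fun i => ?_⟩
    · simp only [Finset.sum_sub_distrib, ← hQ]
      simp
      linarith [Int.emod_add_mul_ediv Q n]
    · by_cases hi : i = 0
      · simp only [hi, if_true, sub_self, Int.zero_ediv]; ring
      · simp only [hi, if_false]
        linarith [Int.emod_add_mul_ediv (s i - s 0) N]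

end Torus

/-! ### The alcove as a fundamental domain of the affine Weyl group -/

section Alcove

variable {n : ℕ}

/-- The integer points in the interior of the dominant Weyl alcove of width `N`. -/
def IsAlcove (N : ℕ) (b : Fin n → ℤ) : Prop := StrictAnti b ∧ ∀ i j, b i - b j < N

/-- Write the difference as d + N q with ∑ q = 0. Entries of q of both signs would make a or b
spread by at least N, so q = 0. Then a ∘ v and b ∘ w differ by a constant, and an order-preserving
permutation is the identity. -/
theorem IsAlcove.eq_of_inLattice [NeZero n] {N : ℕ} [NeZero N] {a b : Fin n → ℤ}
    (ha : IsAlcove N a) (hb : IsAlcove N b) {v w : Equiv.Perm (Fin n)}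
    (h : InLattice N fun i => a (v i) - b (w i)) : v = w ∧ ∃ c, ∀ i, a i = b i + c := by
  have hN : (0 : ℤ) < N := by exact_mod_cast NeZero.pos N
  obtain ⟨d, q, hq, he⟩ := (inLattice_iff N _).1 h
  have hle : ∀ i j, 1 ≤ q i → q j ≤ -1 → False := by
    intro i j hi hj
    have h1 := ha.2 (v i) (v j)
    have h2 := hb.2 (w j) (w i)
    have h3 := he i
    have h4 := he j
    nlinarith
  have hq0 : ∀ i, q i = 0 := by
    by_cases hpos : ∃ i, 1 ≤ q i
    · obtain ⟨i, hi⟩ := hpos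
      have hnn : ∀ j, 0 ≤ q j := fun j => by
        by_contra hj
        exact hle i j hi (by omega)
      intro j
      exact (Finset.sum_eq_zero_iff_of_nonneg fun j _ => hnn j).1 hq j (mem_univ j)
    · push Not at hpos
      intro j
      exact (Finset.sum_eq_zero_iff_of_nonpos fun j _ => by have := hpos j; omega).1 hq j
        (mem_univ j)
  have hab : ∀ i, a (v i) = b (w i) + d := fun i => by
    have := he i
    simp only [hq0 i, mul_zero] at this
    linarith
  have hmono : StrictMono (w.symm.trans v) := by
    intro i j hij
    have h1 : a (v (w.symm i)) = b i + d := by simpa using hab (w.symm i)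
    have h2 : a (v (w.symm j)) = b j + d := by simpa using hab (w.symm j)
    have h3 := hb.1 hij
    exact ha.1.lt_iff_gt.1 (show a (v (w.symm j)) < a (v (w.symm i)) by linarith)
  have hid : ∀ i, v (w.symm i) = i := by
    intro i
    have : (hmono.orderIsoOfSurjective _ (w.symm.trans v).surjective) = OrderIso.refl (Fin n) :=
      Subsingleton.elim _ _
    exact congrArg (fun f : Fin n ≃o Fin n => f i) this
  have hvw : v = w := by
    ext i
    have := hid (w i)
    rw [Equiv.symm_apply_apply] at this
    rw [this]
  refine ⟨hvw, d, fun i => ?_⟩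
  have := hab (w.symm i)
  simpa [hvw] using this

/-- Take a translate of s by N times the root lattice of least squared length. If two entries
differed by more than N, moving N from the larger to the smaller would shorten it; a difference of
exactly N is excluded by `hs`. Then sort. -/
theorem exists_isAlcove [NeZero n] {N : ℕ} [NeZero N] {s : Fin n → ℤ}
    (hs : ∀ i j, i ≠ j → ¬ (N : ℤ) ∣ s i - s j) :
    ∃ (w : Equiv.Perm (Fin n)) (b : Fin n → ℤ), IsAlcove N b ∧
      torusPoint N (b ∘ w) = torusPoint N s := by
  have hN : (0 : ℤ) < N := by exact_mod_cast NeZero.pos N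
  set f : (Fin n → ℤ) → ℕ := fun q => (∑ k, (s k + N * q k) ^ 2).toNat with hf
  obtain ⟨q, hq, hmin⟩ := (InvImage.wf f Nat.lt_wfRel.wf).has_min
    {q : Fin n → ℤ | ∑ i, q i = 0} ⟨0, by simp⟩
  set b : Fin n → ℤ := fun k => s k + N * q k with hb
  have hlt : ∀ i j, b i - b j < N := by
    intro i j
    by_contra hij
    push Not at hij
    have hne : i ≠ j := by rintro rfl; simp at hij; omega
    have hne' : b i - b j ≠ N := fun h => hs i j hne ⟨1 - q i + q j, by
      simp only [hb] at h; linarith⟩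
    refine hmin (fun k => q k + ((if k = j then 1 else 0) - if k = i then 1 else 0)) ?_ ?_
    · have : ∑ k, q k = 0 := hq
      simp [Finset.sum_add_distrib, this]
    · have hkey : ∑ k, (s k + N * (q k + ((if k = j then 1 else 0) - if k = i then 1 else 0))) ^ 2
          = ∑ k, (b k) ^ 2 + 2 * N * (N - (b i - b j)) := by
        have : ∀ k, (s k + N * (q k + ((if k = j then 1 else 0) - if k = i then 1 else 0))) ^ 2
            = (b k) ^ 2 + ((if k = j then 2 * N * b k + N ^ 2 else 0)
              + if k = i then - (2 * N * b k) + N ^ 2 else 0) := by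
          intro k
          simp only [hb]
          by_cases h1 : k = j
          · have h2 : k ≠ i := fun h => hne (h ▸ h1)
            simp only [h1, if_true, hne.symm, if_false]; ring
          · by_cases h2 : k = i
            · simp only [h2, if_true, hne, if_false]; ring
            · simp only [h1, h2, if_false]; ring
        rw [Finset.sum_congr rfl fun k _ => this k]
        simp only [Finset.sum_add_distrib, Finset.sum_ite_eq', mem_univ, if_true]
        ring
      have hnn : 0 ≤ ∑ k, (s k + N * (q k + ((if k = j then 1 else 0) - if k = i then 1 else 0))) ^ 2 :=
        Finset.sum_nonneg fun k _ => sq_nonneg _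
      change (∑ k, (s k + N * (q k + ((if k = j then 1 else 0) - if k = i then 1 else 0))) ^ 2).toNat
        < (∑ k, (b k) ^ 2).toNat
      have : 2 * (N : ℤ) * (N - (b i - b j)) < 0 :=
        mul_neg_of_pos_of_neg (by positivity) (by omega)
      omega
  have hinj : Function.Injective b := by
    intro i j hij
    by_contra hne
    refine hs i j hne ⟨q j - q i, ?_⟩
    simp only [hb] at hij
    linarith
  set σ := Tuple.sort fun i => - b i
  have hσ : StrictAnti (b ∘ σ) := by
    have h1 : Monotone ((fun i => - b i) ∘ σ) := Tuple.monotone_sort _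
    have h2 : StrictMono ((fun i => - b i) ∘ σ) :=
      h1.strictMono_of_injective ((neg_injective.comp hinj).comp σ.injective)
    intro i j hij
    have := h2 hij
    simp only [Function.comp] at this ⊢
    linarith
  refine ⟨σ.symm, b ∘ σ, ⟨hσ, fun i j => hlt _ _⟩, ?_⟩
  rw [torusPoint_eq_iff, inLattice_iff]
  exact ⟨0, q, hq, fun i => by simp [hb]⟩

end Alcove

/-! ### Dominant weights as alcove points -/

section Bead

variable {n : ℕ}

/-- The coordinates `lam_i + n - i` of a partition shifted by the Weyl vector, `i` counted from
one. -/
def bead (lam : Fin n → ℕ) : Fin n → ℤ := fun i => (lam i : ℤ) + (n - 1 - i)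

theorem bead_strictAnti {lam : Fin n → ℕ} (h : Antitone lam) : StrictAnti (bead lam) := by
  intro i j hij
  have h1 := h hij.le
  have h2 : (i : ℕ) < j := hij
  simp only [bead]
  omega

theorem bead_removeColumns [NeZero n] {lam : Fin n → ℕ} (h : Antitone lam) (i : Fin n) :
    bead (removeColumns lam) i = bead lam i - lam (Fin.rev 0) := by
  have h1 : lam (Fin.rev 0) ≤ lam i := h (by rw [← Fin.rev_le_rev]; simp)
  simp only [bead, removeColumns]
  omega

namespace AffineWeight

variable [NeZero n] {k : ℕ}

theorem toPartition_antitone (w : AffineWeight n k) : Antitone w.toPartition := by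
  intro i j hij
  refine Finset.sum_le_sum_of_subset fun p hp => ?_
  simp only [mem_filter, mem_univ, true_and] at hp ⊢
  exact lt_of_le_of_lt hij hp

theorem toPartition_eq_add (w : AffineWeight n k) (i j : Fin n) (p : ZMod n)
    (hp : p.val = i + 1) (hj : (j : ℕ) = i + 1) :
    w.toPartition i = w.1 p + w.toPartition j := by
  unfold toPartition
  rw [show (univ.filter fun q : ZMod n => (i : ℕ) < q.val)
    = insert p (univ.filter fun q : ZMod n => (j : ℕ) < q.val) from ?_, Finset.sum_insert]
  · simp; omega
  · ext q
    simp only [mem_filter, mem_univ, true_and, mem_insert]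
    rw [← (ZMod.val_injective n).eq_iff]
    omega

theorem toPartition_last (w : AffineWeight n k) : w.toPartition (Fin.rev 0) = 0 := by
  unfold toPartition
  rw [Finset.sum_eq_zero]
  intro p hp
  rw [mem_filter, Fin.val_rev, Fin.val_zero] at hp
  have := p.val_lt
  omega

theorem zero_add_toPartition (w : AffineWeight n k) : w.1 0 + w.toPartition 0 = k := by
  conv_rhs => rw [← w.2]
  rw [← Finset.add_sum_erase univ _ (mem_univ (0 : ZMod n))]
  congr 1
  refine Finset.sum_congr ?_ fun _ _ => rfl
  ext q
  rw [mem_filter, mem_erase, Fin.val_zero]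
  simp only [mem_univ, true_and, and_true]
  rw [Nat.pos_iff_ne_zero, Ne, ZMod.val_eq_zero]

theorem toPartition_zero_le (w : AffineWeight n k) : w.toPartition 0 ≤ k := by
  have := w.zero_add_toPartition
  omega

theorem toPartition_injective : Function.Injective (toPartition (n := n) (k := k)) := by
  intro v w h
  ext p
  by_cases hp : p = 0
  · have h1 := v.zero_add_toPartition
    have h2 := w.zero_add_toPartition
    rw [h] at h1
    subst hp
    omega
  · have hp' : p.val ≠ 0 := by rwa [Ne, ZMod.val_eq_zero]
    have hlt := p.val_lt
    have h1 := v.toPartition_eq_add ⟨p.val - 1, by omega⟩ ⟨p.val, hlt⟩ p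
      (by simp only; omega) (by simp only; omega)
    have h2 := w.toPartition_eq_add ⟨p.val - 1, by omega⟩ ⟨p.val, hlt⟩ p
      (by simp only; omega) (by simp only; omega)
    rw [h] at h1
    omega

theorem toPartition_ofPartition (lam : Fin n → ℕ) (hlam : Antitone lam)
    (hk : removeColumns lam 0 ≤ k) : (ofPartition lam hlam hk).toPartition = removeColumns lam := by
  set w := ofPartition lam hlam hk with hw
  suffices h : ∀ d : ℕ, ∀ i : Fin n, (i : ℕ) + d + 1 = n → w.toPartition i = removeColumns lam i by
    ext i
    exact h (n - 1 - i) i (by omega)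
  have hlast : ∀ i : Fin n, lam (Fin.rev 0) ≤ lam i := fun i =>
    hlam (by rw [← Fin.rev_le_rev]; simp)
  intro d
  induction d with
  | zero =>
    intro i hi
    have : i = Fin.rev 0 := Fin.ext (by simp [Fin.val_rev]; omega)
    rw [this, toPartition_last]
    simp [removeColumns]
  | succ d ih =>
    intro i hi
    have hval : ((i + 1 : ℕ) : ZMod n).val = i + 1 := ZMod.val_natCast_of_lt (by omega)
    have hne : ((i + 1 : ℕ) : ZMod n) ≠ 0 := by
      rw [Ne, ← ZMod.val_eq_zero, hval]; omega
    rw [w.toPartition_eq_add i ⟨i + 1, by omega⟩ ((i + 1 : ℕ) : ZMod n) hval rfl,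
      ih ⟨i + 1, by omega⟩ (by simp only; omega)]
    have hl : w.1 ((i + 1 : ℕ) : ZMod n) = lam i - lam ⟨i + 1, by omega⟩ := by
      change labels k lam _ = _
      rw [labels, if_neg hne]
      simp only [hval, Nat.add_sub_cancel]
    rw [hl]
    have h1 : lam ⟨i + 1, by omega⟩ ≤ lam i := hlam (by rw [Fin.le_def]; simp)
    have h2 := hlast ⟨i + 1, by omega⟩
    simp only [removeColumns]
    omega

theorem toPartition_create (j : ZMod n) (w : AffineWeight n k) (i : Fin n) :
    (create j w).toPartition i = w.toPartition i + if (i : ℕ) < j.val then 1 else 0 := by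
  simp only [toPartition, create, Pi.add_apply, Finset.sum_add_distrib]
  congr 1
  rw [Finset.sum_filter]
  rw [Finset.sum_eq_single j]
  · simp
  · intro q _ hq
    simp [hq]
  · simp

/-- Negation in ℤ/n sends the labels counted by the conjugate row to exactly those missing from row
`Fin.rev i`: the diagram is complemented in its bounding rectangle and rotated. -/
theorem toPartition_conj (w : AffineWeight n k) (i : Fin n) :
    w.conj.toPartition i + w.toPartition (Fin.rev i) = w.toPartition 0 := by
  have h1 : w.conj.toPartition i
      = ∑ q : ZMod n with (0 < q.val ∧ q.val ≤ (Fin.rev i : ℕ)), w.1 q := by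
    unfold toPartition conj
    refine Finset.sum_nbij' (fun q => -q) (fun q => -q) ?_ ?_ ?_ ?_ ?_
    · intro q hq
      simp only [mem_filter, mem_univ, true_and, Fin.val_rev] at hq ⊢
      have h0 : q ≠ 0 := by rw [Ne, ← ZMod.val_eq_zero]; omega
      have := q.val_lt
      have : NeZero q := ⟨h0⟩
      rw [ZMod.val_neg_of_ne_zero]
      omega
    · intro q hq
      simp only [mem_filter, mem_univ, true_and, Fin.val_rev] at hq ⊢
      have h0 : q ≠ 0 := by rw [Ne, ← ZMod.val_eq_zero]; omega
      have := q.val_lt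
      have := i.2
      have : NeZero q := ⟨h0⟩
      rw [ZMod.val_neg_of_ne_zero]
      omega
    · simp
    · simp
    · simp
  rw [h1]
  unfold toPartition
  rw [← Finset.sum_union]
  · refine Finset.sum_congr ?_ fun _ _ => rfl
    ext q
    rw [mem_union, mem_filter, mem_filter, mem_filter, Fin.val_zero]
    simp only [mem_univ, true_and]
    omega
  · rw [Finset.disjoint_left]
    intro q hq hq'
    simp only [mem_filter, mem_univ, true_and] at hq hq'
    omega

theorem isAlcove_bead (w : AffineWeight n k) : IsAlcove (k + n) (bead w.toPartition) := by
  refine ⟨bead_strictAnti w.toPartition_antitone, fun i j => ?_⟩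
  have h1 := w.toPartition_zero_le
  have h2 : w.toPartition i ≤ w.toPartition 0 := w.toPartition_antitone (Fin.zero_le i)
  simp only [bead]
  have := i.2
  have := j.2
  push_cast
  omega

theorem eq_of_bead_eq_add {v w : AffineWeight n k} {c : ℤ}
    (h : ∀ i, bead v.toPartition i = bead w.toPartition i + c) : v = w := by
  have h0 := h (Fin.rev 0)
  simp only [bead, toPartition_last] at h0
  refine toPartition_injective (funext fun i => ?_)
  have h1 := h i
  simp only [bead] at h1
  omega

/-- With `isAlcove_bead` and `eq_of_bead_eq_add` this matches the weights of level k with the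
interior alcove points of width k + n modulo constants. -/
theorem exists_bead_of_isAlcove {b : Fin n → ℤ} (hb : IsAlcove (k + n) b) :
    ∃ w : AffineWeight n k, ∃ c : ℤ, ∀ i, b i = bead w.toPartition i + c := by
  have hanti : Antitone fun i : Fin n => b i + (i : ℤ) := by
    obtain _ | m := n
    · exact absurd rfl (NeZero.ne 0)
    · rw [Fin.antitone_iff_succ_le]
      intro i
      have := hb.1 (Fin.castSucc_lt_succ (i := i))
      simp only [Fin.val_succ, Fin.val_castSucc]
      push_cast
      omega
  have hle : ∀ i : Fin n, i ≤ Fin.rev 0 := fun i => by rw [← Fin.rev_le_rev]; simp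
  set lam : Fin n → ℕ := fun i => (b i - b (Fin.rev 0) - (n - 1 - i)).toNat with hlam
  have hpos := NeZero.pos n
  have hcast : ((Fin.rev (0 : Fin n) : ℕ) : ℤ) = n - 1 := by
    simp only [Fin.val_rev, Fin.val_zero]; omega
  have hval : ∀ i, (lam i : ℤ) = b i - b (Fin.rev 0) - (n - 1 - i) := by
    intro i
    have h1 : b (Fin.rev 0) + ((Fin.rev (0 : Fin n) : ℕ) : ℤ) ≤ b i + (i : ℕ) := hanti (hle i)
    rw [hlam, Int.toNat_of_nonneg]
    omega
  have hl : Antitone lam := by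
    intro i j hij
    have h1 : b j + (j : ℕ) ≤ b i + (i : ℕ) := hanti hij
    have h2 := hval i
    have h3 := hval j
    omega
  have hlast : lam (Fin.rev 0) = 0 := by
    have := hval (Fin.rev 0)
    omega
  have hk : removeColumns lam 0 ≤ k := by
    have h1 := hval 0
    have h2 := hb.2 0 (Fin.rev 0)
    simp only [removeColumns]
    push_cast at h2
    simp only [Fin.val_zero] at h1
    omega
  refine ⟨ofPartition lam hl hk, b (Fin.rev 0), fun i => ?_⟩
  rw [toPartition_ofPartition]
  have := hval i
  simp only [bead, removeColumns, hlast]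
  omega

end AffineWeight

end Bead

/-! ### Orthogonality of alternants -/

section Orthogonality

variable {n : ℕ} [NeZero n]

theorem torusPoint_bead_injective {k : ℕ} (σ : AffineWeight n k) :
    Function.Injective (torusPoint (k + n) (bead σ.toPartition)) := by
  have : NeZero (k + n) := ⟨by have := NeZero.pos n; omega⟩
  intro i j h
  rw [torusPoint_apply_eq_iff] at h
  have h1 := σ.isAlcove_bead.2 i j
  have h2 := σ.isAlcove_bead.2 j i
  have h3 := Int.eq_zero_of_abs_lt_dvd h (abs_lt.2 ⟨by linarith, h1⟩)
  exact σ.isAlcove_bead.1.injective (sub_eq_zero.1 h3)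

/-- A torus point with distinct coordinates is a permutation of the point of exactly one weight,
with exactly one permutation; all others contribute zero by `hF`. -/
theorem sum_fundamentalBox_eq_sum_affineWeight {k : ℕ} (F : (Fin n → ℂ) → ℂ)
    (hF : ∀ x i j, i ≠ j → x i = x j → F x = 0)
    (hF' : ∀ x (w : Equiv.Perm (Fin n)), F (x ∘ w) = F x) :
    ∑ d ∈ fundamentalBox n (k + n), F (torusPoint (k + n) d)
      = n.factorial * ∑ σ : AffineWeight n k, F (torusPoint (k + n) (bead σ.toPartition)) := by
  classical
  have : NeZero (k + n) := ⟨by have := NeZero.pos n; omega⟩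
  set g : AffineWeight n k × Equiv.Perm (Fin n) → (Fin n → ℂ) :=
    fun p => torusPoint (k + n) (bead p.1.toPartition ∘ p.2) with hg
  have hinj : Function.Injective g := by
    rintro ⟨σ, v⟩ ⟨τ, w⟩ h
    have h1 := (torusPoint_eq_iff (k + n) _ _).1 h
    obtain ⟨hvw, c, hc⟩ := σ.isAlcove_bead.eq_of_inLattice τ.isAlcove_bead h1
    exact Prod.ext (AffineWeight.eq_of_bead_eq_add hc) hvw
  have hB : ∑ p, F (g p)
      = n.factorial * ∑ σ : AffineWeight n k, F (torusPoint (k + n) (bead σ.toPartition)) := by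
    rw [Fintype.sum_prod_type, Finset.mul_sum]
    refine Finset.sum_congr rfl fun σ _ => ?_
    simp only [hg, torusPoint_comp, hF']
    simp [Fintype.card_perm]
  rw [← hB, ← Finset.sum_image (f := F) (torusPoint_injOn_fundamentalBox (n := n) (k + n)),
    ← Finset.sum_image (f := F) hinj.injOn]
  symm
  refine Finset.sum_subset ?_ ?_
  · intro y hy
    obtain ⟨p, _, rfl⟩ := mem_image.1 hy
    obtain ⟨d, hd, h⟩ := exists_mem_fundamentalBox (k + n) (bead p.1.toPartition ∘ p.2)
    exact mem_image.2 ⟨d, hd, h⟩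
  · intro y hy hy'
    obtain ⟨d, _, rfl⟩ := mem_image.1 hy
    by_contra hne
    refine hy' (mem_image.2 ?_)
    obtain ⟨w, b, hb, h⟩ := exists_isAlcove (N := k + n) (s := d) fun i j hij hdvd =>
      hne (hF _ i j hij ((torusPoint_apply_eq_iff (k + n) d i j).2 hdvd))
    obtain ⟨σ, c, hc⟩ := AffineWeight.exists_bead_of_isAlcove hb
    refine ⟨(σ, w), mem_univ _, h ▸ ?_⟩
    rw [hg, torusPoint_eq_iff, inLattice_iff]
    exact ⟨-c, 0, by simp, fun i => by simp [hc]⟩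

/-- Times n!, this is a sum over the whole box, where orthogonality of characters keeps only the n!
pairs v = w, each with sign product 1, and only if μ = ν. -/
theorem sum_alternant_mul_alternant {k : ℕ} (μ ν : AffineWeight n k) :
    ∑ σ : AffineWeight n k, alternant (torusPoint (k + n) (bead σ.toPartition)) (bead μ.toPartition)
        * alternant (torusPoint (k + n) (bead σ.toPartition)) (fun i => -bead ν.toPartition i)
      = if μ = ν then (n * (k + n : ℕ) ^ (n - 1) : ℂ) else 0 := by
  classical
  have : NeZero (k + n) := ⟨by have := NeZero.pos n; omega⟩
  have hfac : (n.factorial : ℂ) ≠ 0 := by exact_mod_cast n.factorial_ne_zero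
  refine mul_left_cancel₀ hfac ?_
  rw [← sum_fundamentalBox_eq_sum_affineWeight (fun x => alternant x (bead μ.toPartition)
    * alternant x fun i => -bead ν.toPartition i)]
  · simp_rw [alternant_mul_alternant _ (torusPoint_ne_zero (k + n) _)]
    rw [Finset.sum_comm]
    simp_rw [fun v => Finset.sum_comm (s := fundamentalBox n (k + n)) (t := univ)
      (f := fun d w => ((Equiv.Perm.sign v : ℤ) : ℂ) * ((Equiv.Perm.sign w : ℤ) : ℂ) *
        ∏ i, torusPoint (k + n) d i ^ (bead μ.toPartition (v i) + -bead ν.toPartition (w i))),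
      ← Finset.mul_sum, sum_fundamentalBox]
    have hiff : ∀ v w : Equiv.Perm (Fin n), InLattice (k + n)
        (fun i => bead μ.toPartition (v i) + -bead ν.toPartition (w i)) ↔ v = w ∧ μ = ν := by
      intro v w
      constructor
      · intro h
        obtain ⟨hvw, c, hc⟩ := μ.isAlcove_bead.eq_of_inLattice ν.isAlcove_bead
          (v := v) (w := w) (by simpa only [sub_eq_add_neg] using h)
        exact ⟨hvw, AffineWeight.eq_of_bead_eq_add hc⟩
      · rintro ⟨rfl, rfl⟩ i
        simp
    simp_rw [hiff]
    by_cases h : μ = ν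
    · simp only [h, and_true, if_true, mul_ite, mul_zero, Finset.sum_ite_eq, mem_univ]
      have : ∀ v : Equiv.Perm (Fin n),
          ((Equiv.Perm.sign v : ℤ) : ℂ) * ((Equiv.Perm.sign v : ℤ) : ℂ) = 1 := fun v => by
        rcases Int.units_eq_one_or (Equiv.Perm.sign v) with h | h <;> simp [h]
      simp [this, Fintype.card_perm]
    · simp [h]
  · intro x i j hij h
    rw [alternant_eq_zero_of_eq hij h, zero_mul]
  · intro x w
    rw [alternant_comp_left, alternant_comp_left]
    rcases Int.units_eq_one_or (Equiv.Perm.sign w) with h | h <;> simp [h]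

-- The exponents n - 1 - i give a Vandermonde determinant with reversed columns.
omit [NeZero n] in
theorem alternant_bead_zero_ne_zero {x : Fin n → ℂ} (hx : Function.Injective x) :
    alternant x (bead fun _ => 0) ≠ 0 := by
  intro h
  have h1 := alternant_comp_right x (bead fun _ => 0) Fin.revPerm
  rw [h, mul_zero, alternant_eq_det] at h1
  refine Matrix.det_vandermonde_ne_zero_iff.2 hx (Eq.trans ?_ h1)
  congr 1
  ext i j
  simp only [Matrix.vandermonde_apply, Matrix.of_apply, Function.comp, Fin.revPerm_apply, bead,
    Fin.val_rev]
  rw [← zpow_natCast]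
  congr 1
  omega

theorem sign_revPerm (n : ℕ) :
    Equiv.Perm.sign (Fin.revPerm : Equiv.Perm (Fin n)) = (-1) ^ (n * (n - 1) / 2) := by
  rw [Equiv.Perm.sign_eq_prod_prod_Iio, ← Finset.sum_range_id, ← Fin.sum_univ_eq_sum_range,
    ← Finset.prod_pow_eq_pow_sum]
  refine Finset.prod_congr rfl fun j _ => ?_
  rw [Finset.prod_congr rfl (g := fun _ => -1), Finset.prod_const, Fin.card_Iio]
  intro i hi
  have : ¬ Fin.revPerm i < Fin.revPerm j := by
    simpa using (mem_Iio.1 hi).le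
  rw [if_neg this]

/-- The exponents of the conjugate are the negated ones in reverse order, shifted by ν_1 + n - 1.
The sign of the reversal cancels against the squared phase in `kacPetersonFactor_sq`. -/
theorem alternant_bead_conj {k : ℕ} (ν : AffineWeight n k) {x : Fin n → ℂ} (hx : ∀ i, x i ≠ 0)
    (hp : ∏ i, x i = 1) : alternant x (bead ν.conj.toPartition)
      = (-1) ^ (n * (n - 1) / 2) * alternant x fun i => -bead ν.toPartition i := by
  have h1 := alternant_comp_right x (fun i => -bead ν.toPartition i) Fin.revPerm
  rw [sign_revPerm] at h1
  push_cast at h1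
  rw [← h1, ← alternant_add_const hx hp ((fun i => -bead ν.toPartition i) ∘ Fin.revPerm)
    (ν.toPartition 0 + (n - 1))]
  congr 1
  ext i
  have h2 := ν.toPartition_conj i
  simp only [bead, Function.comp, Fin.revPerm_apply, Fin.val_rev]
  have := i.2
  omega

end Orthogonality

/-! ### The S-matrix in terms of alternants -/

section ModularS

variable {n : ℕ}

/-- The factor in front of the alternating sum in the Kac–Peterson formula. -/
noncomputable def kacPetersonFactor (n k : ℕ) : ℂ :=
  Complex.exp (Complex.I * Real.pi * (n * (n - 1)) / 4)
      / (Real.sqrt (n * ((k : ℝ) + n) ^ (n - 1)) : ℝ)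

theorem finiteWeight_add_weylVector [NeZero n] (lam : Fin n → ℕ) (i : Fin n) :
    finiteWeight lam i + weylVector n i = bead lam i - (∑ j, (bead lam j : ℝ)) / n := by
  have hn : (n : ℝ) ≠ 0 := by exact_mod_cast NeZero.ne n
  have hsum : ∑ j : Fin n, ((j : ℕ) : ℝ) = n * (n - 1) / 2 := by
    rw [Fin.sum_univ_eq_sum_range fun j => (j : ℝ)]
    have := Finset.sum_range_id_mul_two n
    have h2 : ((∑ i ∈ range n, i : ℕ) : ℝ) * 2 = n * (n - 1 : ℕ) := by exact_mod_cast this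
    rw [Nat.cast_sub (NeZero.one_le)] at h2
    push_cast at h2
    linarith
  simp only [finiteWeight, weylVector, bead]
  push_cast
  simp only [Finset.sum_add_distrib, Finset.sum_sub_distrib, hsum, Finset.sum_const,
    Finset.card_univ, Fintype.card_fin, nsmul_eq_mul]
  field_simp
  ring

theorem torusRoot_zpow (n N : ℕ) (z : ℤ) :
    torusRoot n N ^ z = Complex.exp (-(2 * Real.pi * Complex.I / (n * N)) * z) := by
  rw [torusRoot, ← Complex.exp_neg, ← Complex.exp_int_mul]
  push_cast
  ring_nf

/-- The coordinates of `torusPoint` are already centred, so centring the exponents as well changes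
nothing; reindexing by w moves the permutation onto `sig`. -/
theorem modularS_eq [NeZero n] (k : ℕ) (lam sig : Fin n → ℕ) :
    modularS k lam sig
      = kacPetersonFactor n k * alternant (torusPoint (k + n) (bead sig)) (bead lam) := by
  have hn : (n : ℂ) ≠ 0 := by exact_mod_cast NeZero.ne n
  have hN : ((k : ℂ) + n) ≠ 0 := by
    have := NeZero.pos n
    exact_mod_cast (by omega : k + n ≠ 0)
  rw [modularS, kacPetersonFactor, alternant]
  congr 1
  refine Finset.sum_congr rfl fun w _ => ?_
  congr 1
  simp only [torusPoint, torusRoot_zpow, ← Complex.exp_int_mul]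
  rw [← Complex.exp_sum]
  congr 1
  have hr : ∑ i, (finiteWeight sig i + weylVector n i)
      * (finiteWeight lam (w⁻¹ i) + weylVector n (w⁻¹ i))
      = ∑ i, ((bead sig (w i) : ℝ) - (∑ j, (bead sig j : ℝ)) / n) * bead lam i := by
    rw [← Equiv.sum_comp w]
    simp only [finiteWeight_add_weylVector, Equiv.Perm.coe_inv, Equiv.symm_apply_apply, mul_sub,
      Finset.sum_sub_distrib, ← Finset.sum_mul]
    rw [Equiv.sum_comp w fun i => (bead sig i : ℝ)]
    have : (n : ℝ) ≠ 0 := by exact_mod_cast NeZero.ne n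
    simp
    field_simp
    simp
  rw [hr, Complex.ofReal_sum, Finset.mul_sum]
  refine Finset.sum_congr rfl fun i _ => ?_
  push_cast
  field_simp

theorem kacPetersonFactor_sq [NeZero n] (k : ℕ) : kacPetersonFactor n k * kacPetersonFactor n k
    * ((-1) ^ (n * (n - 1) / 2) * (n * (k + n : ℕ) ^ (n - 1))) = 1 := by
  have hpos := NeZero.pos n
  have hR : (0 : ℝ) < n * ((k : ℝ) + n) ^ (n - 1) := by positivity
  have hsq : ((Real.sqrt (n * ((k : ℝ) + n) ^ (n - 1)) : ℝ) : ℂ)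
      * (Real.sqrt (n * ((k : ℝ) + n) ^ (n - 1)) : ℝ) = n * (k + n : ℕ) ^ (n - 1) := by
    rw [← Complex.ofReal_mul, Real.mul_self_sqrt hR.le]
    push_cast
    rfl
  have hne : (n * (k + n : ℕ) ^ (n - 1) : ℂ) ≠ 0 := by
    rw [← hsq]
    exact mul_self_ne_zero.2 (Complex.ofReal_ne_zero.2 (Real.sqrt_pos.2 hR).ne')
  have hexp : Complex.exp (Complex.I * Real.pi * (n * (n - 1)) / 4)
      * Complex.exp (Complex.I * Real.pi * (n * (n - 1)) / 4) = (-1) ^ (n * (n - 1) / 2) := by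
    rw [← Complex.exp_add, ← Complex.exp_pi_mul_I, ← Complex.exp_nat_mul]
    congr 1
    have h2 : ((n * (n - 1) / 2 : ℕ) : ℂ) * 2 = n * (n - 1) := by
      have h3 : n * (n - 1) / 2 * 2 = n * (n - 1) :=
        Nat.div_mul_cancel (Nat.even_mul_pred_self n).two_dvd
      have h4 : ((n * (n - 1) / 2 * 2 : ℕ) : ℂ) = (n * (n - 1) : ℕ) := by rw [h3]
      rw [Nat.cast_mul n, Nat.cast_sub NeZero.one_le] at h4
      push_cast at h4 ⊢
      exact h4
    rw [← h2]
    ring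
  rw [kacPetersonFactor, div_mul_div_comm, hexp, hsq, div_mul_eq_mul_div, ← mul_assoc, ← pow_add,
    ← two_mul, pow_mul]
  rw [neg_one_sq, one_pow, one_mul, div_self hne]

theorem kacPetersonFactor_ne_zero [NeZero n] (k : ℕ) : kacPetersonFactor n k ≠ 0 := by
  intro h
  have := kacPetersonFactor_sq (n := n) k
  simp [h] at this

/-- Row orthogonality of the S-matrix, with the row of ν* in the role of a complex conjugate. -/
theorem sum_modularS_mul_modularS_conj [NeZero n] {k : ℕ} (μ ν : AffineWeight n k) :
    ∑ σ : AffineWeight n k, modularS k μ.toPartition σ.toPartition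
      * modularS k ν.conj.toPartition σ.toPartition = if μ = ν then 1 else 0 := by
  have h : ∀ σ : AffineWeight n k, modularS k μ.toPartition σ.toPartition
      * modularS k ν.conj.toPartition σ.toPartition
      = (kacPetersonFactor n k * kacPetersonFactor n k * (-1) ^ (n * (n - 1) / 2)) *
        (alternant (torusPoint (k + n) (bead σ.toPartition)) (bead μ.toPartition)
        * alternant (torusPoint (k + n) (bead σ.toPartition)) fun i => -bead ν.toPartition i) := by
    intro σ
    rw [modularS_eq, modularS_eq, alternant_bead_conj _ (torusPoint_ne_zero _ _)
      (prod_torusPoint _ _)]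
    ring
  simp_rw [h]
  rw [← Finset.mul_sum, sum_alternant_mul_alternant]
  split_ifs
  · rw [mul_assoc, kacPetersonFactor_sq]
  · rw [mul_zero]

theorem modularS_zero_ne_zero [NeZero n] {k : ℕ} (σ : AffineWeight n k) :
    modularS k (fun _ => 0) σ.toPartition ≠ 0 := by
  rw [modularS_eq]
  exact mul_ne_zero (kacPetersonFactor_ne_zero k)
    (alternant_bead_zero_ne_zero (torusPoint_bead_injective σ))

theorem modularS_removeColumns [NeZero n] (k : ℕ) {lam : Fin n → ℕ} (h : Antitone lam)
    (sig : Fin n → ℕ) : modularS k (removeColumns lam) sig = modularS k lam sig := by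
  rw [modularS_eq, modularS_eq, ← alternant_add_const (torusPoint_ne_zero _ _)
    (prod_torusPoint _ _) _ (lam (Fin.rev 0))]
  congr 2
  ext i
  rw [bead_removeColumns h]
  ring

end ModularS

/-! ### The Pieri rule at level k and the fusion coefficients of columns -/

section Pieri

variable {n : ℕ}

/-- The composition `lam` with the rows in `I` made longer by one. -/
def addStrip (lam : Fin n → ℕ) (I : Finset (Fin n)) : Fin n → ℕ :=
  fun i => lam i + if i ∈ I then 1 else 0

theorem raise_bead (lam : Fin n → ℕ) (I : Finset (Fin n)) :
    raise (bead lam) I = bead (addStrip lam I) := by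
  ext i
  simp only [raise, bead, addStrip]
  split_ifs <;> push_cast <;> ring

/-- Monotonicity fails only where two equal adjacent rows gain a box in the lower one alone, and
then their exponents coincide. -/
theorem alternant_bead_addStrip_eq_zero {lam : Fin n → ℕ} (hlam : Antitone lam)
    {I : Finset (Fin n)} (h : ¬ Antitone (addStrip lam I)) (x : Fin n → ℂ) :
    alternant x (bead (addStrip lam I)) = 0 := by
  obtain _ | m := n
  · exact absurd (fun i => i.elim0) h
  rw [Fin.antitone_iff_succ_le] at h
  push Not at h
  obtain ⟨i, hi⟩ := h
  refine alternant_eq_zero_of_proportional (Fin.castSucc_lt_succ (i := i)).ne 1 fun p => ?_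
  rw [one_mul]
  congr 1
  have h1 := hlam (Fin.castSucc_lt_succ (i := i)).le
  simp only [addStrip, bead, Fin.val_succ, Fin.val_castSucc] at hi ⊢
  split_ifs at hi ⊢ <;> push_cast <;> omega

theorem elementarySymm_mul_alternant_bead (r : ℕ) {x : Fin n → ℂ} (hx : ∀ i, x i ≠ 0)
    (lam : Fin n → ℕ) : elementarySymm r x * alternant x (bead lam)
      = ∑ I ∈ powersetCard r univ, alternant x (bead (addStrip lam I)) := by
  rw [elementarySymm_mul_alternant r hx]
  simp_rw [raise_bead]

/-- Adding r boxes in distinct rows to the empty partition gives a partition only for the first r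
rows. -/
theorem alternant_bead_column {r : ℕ} (hr : r ≤ n) {x : Fin n → ℂ} (hx : ∀ i, x i ≠ 0) :
    alternant x (bead (column n r)) = elementarySymm r x * alternant x (bead fun _ => 0) := by
  set J : Finset (Fin n) := univ.filter fun i => (i : ℕ) < r with hJ
  have hcard : J.card = r := by
    rw [hJ, Fin.card_filter_val_lt, min_eq_right hr]
  rw [elementarySymm_mul_alternant_bead r hx, Finset.sum_eq_single J]
  · congr 2
    ext i
    simp [column, addStrip, hJ]
  · intro I hI hne
    refine alternant_bead_addStrip_eq_zero antitone_const (fun hanti => hne ?_) x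
    have hIr : I.card = r := (mem_powersetCard.1 hI).2
    refine Finset.eq_of_subset_of_card_le (fun i hi => ?_) (by omega)
    have h1 : Finset.Iic i ⊆ I := fun j hj => by
      have := hanti (mem_Iic.1 hj)
      by_contra hj'
      simp [addStrip, hi, hj'] at this
    have h2 := Finset.card_le_card h1
    rw [Fin.card_Iic] at h2
    simp only [hJ, mem_filter, mem_univ, true_and]
    omega
  · intro h
    exact absurd (mem_powersetCard.2 ⟨subset_univ _, hcard⟩) h

variable [NeZero n]

/-- Vanishing on the affine wall: all coordinates have the same N-th power, so the two columns are
proportional. -/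
theorem alternant_torusPoint_eq_zero {N : ℕ} [NeZero N] (s : Fin n → ℤ) {b : Fin n → ℤ}
    {i j : Fin n} (h : b i = b j + N) : alternant (torusPoint N s) b = 0 := by
  have hij : i ≠ j := by
    rintro rfl
    exact NeZero.ne N (by omega)
  refine alternant_eq_zero_of_proportional hij (torusRoot n N ^ (-(N * ∑ j, s j) : ℤ)) fun p => ?_
  rw [h, zpow_add₀ (torusPoint_ne_zero N s p), torusPoint_zpow_level, mul_comm]

/-- The coordinates `x` of the weight `σ` at which the characters of the fusion ring are
evaluated. -/
noncomputable def AffineWeight.point {k : ℕ} (σ : AffineWeight n k) : Fin n → ℂ :=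
  torusPoint (k + n) (bead σ.toPartition)

theorem AffineWeight.point_ne_zero {k : ℕ} (σ : AffineWeight n k) (i : Fin n) : σ.point i ≠ 0 :=
  torusPoint_ne_zero _ _ i

theorem AffineWeight.prod_point {k : ℕ} (σ : AffineWeight n k) : ∏ i, σ.point i = 1 :=
  prod_torusPoint _ _

theorem modularS_eq_point {k : ℕ} (lam : Fin n → ℕ) (σ : AffineWeight n k) :
    modularS k lam σ.toPartition = kacPetersonFactor n k * alternant σ.point (bead lam) :=
  modularS_eq k lam _

/-- The weight `ν` arises from `μ` by adding a box to the rows in `I`, up to columns of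
length `n`. -/
def IsHop {k : ℕ} (μ ν : AffineWeight n k) (I : Finset (Fin n)) : Prop :=
  ∃ c : ℤ, ∀ i, raise (bead μ.toPartition) I i = bead ν.toPartition i + c

open Classical in
/-- The number of ways to obtain the weight `ν` from `μ` by adding a box to `r` rows. -/
noncomputable def hopCount {k : ℕ} (r : ℕ) (μ ν : AffineWeight n k) : ℕ :=
  ((powersetCard r univ).filter (IsHop μ ν)).card

-- Either the raised vector is in the alcove and determines a unique ν, or two of its entries
-- coincide, or its spread reaches k + n. In the last two cases the alternant vanishes.
open Classical in
theorem alternant_raise_bead {k : ℕ} (μ σ : AffineWeight n k) (I : Finset (Fin n)) :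
    alternant σ.point (raise (bead μ.toPartition) I)
      = ∑ ν : AffineWeight n k,
        if IsHop μ ν I then alternant σ.point (bead ν.toPartition) else 0 := by
  have : NeZero (k + n) := ⟨by have := NeZero.pos n; omega⟩
  by_cases h : ∃ ν : AffineWeight n k, IsHop μ ν I
  · obtain ⟨ν, c, hc⟩ := h
    rw [Finset.sum_eq_single ν]
    · rw [if_pos ⟨c, hc⟩, ← alternant_add_const σ.point_ne_zero σ.prod_point (bead ν.toPartition) c]
      exact congrArg _ (funext hc)
    · rintro ν' - hne
      refine if_neg fun ⟨c', hc'⟩ => hne (AffineWeight.eq_of_bead_eq_add (c := c - c') fun i => ?_)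
      have h1 := hc i
      have h2 := hc' i
      omega
    · simp
  · push Not at h
    rw [Finset.sum_eq_zero fun ν _ => if_neg (h ν)]
    set b := raise (bead μ.toPartition) I with hb
    have hbi : ∀ i, bead μ.toPartition i ≤ b i ∧ b i ≤ bead μ.toPartition i + 1 := fun i => by
      simp only [hb, raise]
      split_ifs <;> omega
    by_cases hinj : Function.Injective b
    · have hanti : StrictAnti b := fun i j hij => by
        have h1 := μ.isAlcove_bead.1 hij
        have h2 := hinj.ne hij.ne
        have h3 := hbi i
        have h4 := hbi j
        omega
      have hw : ∃ i j, ((k + n : ℕ) : ℤ) ≤ b i - b j := by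
        by_contra hcon
        push Not at hcon
        obtain ⟨ν, c, hc⟩ := AffineWeight.exists_bead_of_isAlcove (k := k) ⟨hanti, hcon⟩
        exact h ν ⟨c, hc⟩
      obtain ⟨i, j, hij⟩ := hw
      -- The spread was below k + n and grew by at most one, so it is exactly k + n.
      refine alternant_torusPoint_eq_zero _ (i := i) (j := j) ?_
      have h1 := μ.isAlcove_bead.2 i j
      have h3 := hbi i
      have h4 := hbi j
      omega
    · simp only [Function.Injective] at hinj
      push Not at hinj
      obtain ⟨i, j, hij, hne⟩ := hinj
      exact alternant_eq_zero_of_proportional hne 1 fun p => by rw [hij, one_mul]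

/-- For fixed σ, the S-matrix column is an eigenvector of every hop matrix, with eigenvalue e_r at
`σ.point`. -/
theorem elementarySymm_mul_modularS {k : ℕ} (r : ℕ) (μ σ : AffineWeight n k) :
    elementarySymm r σ.point * modularS k μ.toPartition σ.toPartition
      = ∑ ν : AffineWeight n k, (hopCount r μ ν : ℂ) * modularS k ν.toPartition σ.toPartition := by
  classical
  simp only [modularS_eq_point]
  rw [mul_left_comm, elementarySymm_mul_alternant r σ.point_ne_zero]
  simp_rw [alternant_raise_bead]
  rw [Finset.sum_comm, Finset.mul_sum]
  refine Finset.sum_congr rfl fun ν _ => ?_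
  rw [← Finset.sum_filter, Finset.sum_const, hopCount, nsmul_eq_mul]
  ring_nf

theorem modularS_column {k r : ℕ} (hr : r ≤ n) (σ : AffineWeight n k) :
    modularS k (column n r) σ.toPartition
      = elementarySymm r σ.point * modularS k (fun _ => 0) σ.toPartition := by
  rw [modularS_eq_point, modularS_eq_point, alternant_bead_column hr σ.point_ne_zero,
    mul_left_comm]

theorem verlindeSum_eq {k : ℕ} {lam : Fin n → ℕ} {g : AffineWeight n k → ℂ}
    (hg : ∀ σ : AffineWeight n k,
      modularS k lam σ.toPartition = g σ * modularS k (fun _ => 0) σ.toPartition)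
    (μ ν : AffineWeight n k) :
    verlindeSum lam μ ν = ∑ σ : AffineWeight n k, g σ *
      (modularS k μ.toPartition σ.toPartition * modularS k ν.conj.toPartition σ.toPartition) := by
  unfold verlindeSum
  refine Finset.sum_congr rfl fun σ _ => ?_
  rw [hg σ, div_eq_iff (modularS_zero_ne_zero σ)]
  ring

theorem verlindeSum_removeColumns {k : ℕ} {lam : Fin n → ℕ} (h : Antitone lam)
    (μ ν : AffineWeight n k) : verlindeSum (removeColumns lam) μ ν = verlindeSum lam μ ν := by
  simp only [verlindeSum, modularS_removeColumns k h]

theorem fusionCoeff_ofPartition {k : ℕ} {lam : Fin n → ℕ} (h : Antitone lam)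
    (hk : removeColumns lam 0 ≤ k) (μ ν : AffineWeight n k) :
    fusionCoeff (AffineWeight.ofPartition lam h hk) μ ν = verlindeSum lam μ ν := by
  rw [fusionCoeff, AffineWeight.toPartition_ofPartition, verlindeSum_removeColumns h]

/-- The first and last exponents differ by (k + 1) + (n - 1) = k + n, the affine wall. -/
theorem verlindeSum_eq_zero {k : ℕ} {lam : Fin n → ℕ} (hk : removeColumns lam 0 = k + 1)
    (μ ν : AffineWeight n k) : verlindeSum lam μ ν = 0 := by
  have : NeZero (k + n) := ⟨by have := NeZero.pos n; omega⟩
  rw [verlindeSum_eq (g := 0)]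
  · simp
  · intro σ
    rw [modularS_eq, alternant_torusPoint_eq_zero (i := 0) (j := Fin.rev 0)]
    · simp
    · simp only [removeColumns] at hk
      simp only [bead, Fin.val_rev, Fin.val_zero]
      have := NeZero.pos n
      push_cast
      omega

theorem fusionCoeff_ofColumn {k r : ℕ} (hk : 1 ≤ k) (hr : r ≤ n) (μ ν : AffineWeight n k) :
    fusionCoeff (AffineWeight.ofColumn r hk) μ ν = hopCount r μ ν := by
  rw [show fusionCoeff (AffineWeight.ofColumn r hk) μ ν = verlindeSum (column n r) μ ν from
    fusionCoeff_ofPartition _ _ _ _, verlindeSum_eq (modularS_column hr)]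
  simp_rw [← mul_assoc, elementarySymm_mul_modularS, Finset.sum_mul, mul_assoc]
  rw [Finset.sum_comm]
  simp_rw [← Finset.mul_sum, sum_modularS_mul_modularS_conj]
  simp

/-- Adding ω̂_j translates both exponent vectors by the same vector, and `IsHop` depends only on
their difference, not on the level. -/
theorem hopCount_create {k : ℕ} (r : ℕ) (j : ZMod n) (μ ν : AffineWeight n k) :
    hopCount r (AffineWeight.create j μ) (AffineWeight.create j ν) = hopCount r μ ν := by
  unfold hopCount
  congr 2
  ext I
  refine exists_congr fun c => forall_congr' fun i => ?_
  simp only [raise, bead, AffineWeight.toPartition_create]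
  push_cast
  constructor <;> intro h <;> linarith

end Pieri

/-! ### Sums over paths -/

section Paths

/-- A product of matrices is applied to a common eigenvector v. Paths run backwards, from μ at the
last index to a free end at index 0, weighted by v. -/
theorem sum_paths {P : Type*} [Fintype P] [DecidableEq P] (v : P → ℂ) {l : ℕ}
    (M : Fin l → P → P → ℂ) (e : Fin l → ℂ)
    (h : ∀ i μ, e i * v μ = ∑ ν, M i μ ν * v ν) (μ : P) :
    ∑ S : Fin (l + 1) → P with S (Fin.last l) = μ,
      (∏ i : Fin l, M i (S i.succ) (S i.castSucc)) * v (S 0) = (∏ i, e i) * v μ := by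
  induction l generalizing μ with
  | zero =>
    rw [Finset.sum_eq_single fun _ => μ]
    · simp
    · intro S hS hne
      refine absurd (funext fun i => ?_) hne
      rw [Subsingleton.elim (α := Fin 1) i (Fin.last 0)]
      exact (mem_filter.1 hS).2
    · simp
  | succ l ih =>
    rw [Finset.sum_filter, ← Equiv.sum_comp (Fin.snocEquiv fun _ => P), Fintype.sum_prod_type]
    simp only [Fin.snocEquiv_apply, Fin.snoc_last]
    rw [Finset.sum_eq_single μ]
    · simp only [if_true]
      rw [Fin.prod_univ_castSucc, mul_assoc, h, Finset.mul_sum]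
      -- Sorting by the vertex before μ makes the induction hypothesis applicable.
      rw [← Finset.sum_fiberwise (univ : Finset (Fin (l + 1) → P)) fun S => S (Fin.last l)]
      refine Finset.sum_congr rfl fun ν _ => ?_
      rw [mul_left_comm, ← ih (fun i => M i.castSucc) (fun i => e i.castSucc)
        (fun i => h i.castSucc) ν, Finset.mul_sum]
      refine Finset.sum_congr rfl fun S hS => ?_
      have hS' : S (Fin.last l) = ν := (mem_filter.1 hS).2
      rw [Fin.prod_univ_castSucc]
      have h0 : (Fin.snoc S μ : Fin (l + 1 + 1) → P) 0 = S 0 :=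
        Fin.snoc_castSucc (α := fun _ => P) μ S 0
      simp only [Fin.succ_last, Fin.snoc_last, Fin.snoc_castSucc, hS', h0, Fin.succ_castSucc]
      ring
    · intro ν _ hν
      simp [hν]
    · simp

/-- Orthogonality expresses the condition `S 0 = ν` as a sum over σ; for each σ the paths with free
end are then summed by `sum_paths`. -/
theorem sum_paths_fusionCoeff {n k : ℕ} [NeZero n] {l : ℕ} (α : Fin l → ℕ) (hα : ∀ i, α i ≤ n)
    (j : Fin l → ZMod n) (μ ν : AffineWeight n k) :
    ∑ S : Fin (l + 1) → AffineWeight n k with S 0 = ν ∧ S (Fin.last l) = μ,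
        ∏ i : Fin l, fusionCoeff (AffineWeight.ofColumn (α i) (Nat.le_add_left 1 k))
          (AffineWeight.create (j i) (S i.succ)) (AffineWeight.create (j i) (S i.castSucc))
      = ∑ σ : AffineWeight n k, (∏ i, elementarySymm (α i) σ.point) *
        (modularS k μ.toPartition σ.toPartition
          * modularS k ν.conj.toPartition σ.toPartition) := by
  simp_rw [fun i => fusionCoeff_ofColumn (n := n) (Nat.le_add_left 1 k) (hα i), hopCount_create,
    ← mul_assoc, fun σ : AffineWeight n k => (sum_paths
      (fun μ : AffineWeight n k => modularS k μ.toPartition σ.toPartition)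
      (fun i μ ν => (hopCount (α i) μ ν : ℂ)) _
      (fun i μ => elementarySymm_mul_modularS (α i) μ σ) μ).symm, Finset.sum_mul, mul_assoc]
  rw [Finset.sum_comm]
  simp_rw [← Finset.mul_sum, sum_modularS_mul_modularS_conj]
  simp_rw [mul_ite, mul_one, mul_zero]
  rw [← Finset.sum_filter, Finset.filter_filter]
  simp_rw [and_comm]

end Paths

/-! ### Kostka numbers as counts of strip chains -/

section Kostka

variable {n l : ℕ}

/-- The strip with number `s` of the sequence `I` contains the column `c`. -/
def InStrip (I : Fin l → Finset (Fin n)) (c : Fin n) (s : ℕ) : Prop :=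
  ∃ h : s < l, c ∈ I ⟨s, h⟩

instance (I : Fin l → Finset (Fin n)) (c : Fin n) : DecidablePred (InStrip I c) :=
  fun s => inferInstanceAs (Decidable (∃ h : s < l, c ∈ I ⟨s, h⟩))

/-- The column lengths of the union of the first `t` strips of a sequence. -/
def stripShape (I : Fin l → Finset (Fin n)) (t : ℕ) : Fin n → ℕ :=
  fun c => Nat.count (InStrip I c) t

/-- The sequence `I` describes a chain of diagrams in which the successive differences are strips
of sizes `α`. -/
def IsStripChain (α : Fin l → ℕ) (I : Fin l → Finset (Fin n)) : Prop :=
  (∀ s, (I s).card = α s) ∧ ∀ t ≤ l, Antitone (stripShape I t)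

/-- `α` is the weight of the tableau `T`. -/
def HasContent {Y : YoungDiagram} (α : Fin l → ℕ) (T : SemistandardYoungTableau Y) : Prop :=
  ∀ i : ℕ, (Y.cells.filter fun c => T c.1 c.2 = i).card = if h : i < l then α ⟨i, h⟩ else 0

/-- The diagram `Y` has column lengths `lam`. -/
def HasColumns (Y : YoungDiagram) (lam : Fin n → ℕ) : Prop :=
  ∀ r c, (r, c) ∈ Y ↔ ∃ h : c < n, r < lam ⟨c, h⟩

theorem hasColumns_transpose_youngDiagram (lam : Fin n → ℕ) (hlam : Antitone lam) :
    HasColumns (youngDiagram lam hlam).transpose lam := by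
  intro r c
  simp only [youngDiagram, YoungDiagram.mem_transpose, Prod.swap_prod_mk,
    YoungDiagram.mem_ofRowLens, List.length_ofFn, List.getElem_ofFn]

/-- The strips of cells with equal entries in a tableau, as sets of columns. -/
def tableauStrips {Y : YoungDiagram} (lam : Fin n → ℕ) (l : ℕ) (T : SemistandardYoungTableau Y) :
    Fin l → Finset (Fin n) :=
  fun s => univ.filter fun c => ∃ r ∈ range (lam c), T r c = s

variable {Y : YoungDiagram} {lam : Fin n → ℕ} {α : Fin l → ℕ}

theorem HasColumns.mem (hY : HasColumns Y lam) {r : ℕ} {c : Fin n} (h : r < lam c) :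
    (r, (c : ℕ)) ∈ Y :=
  (hY r c).2 ⟨c.2, h⟩

theorem HasColumns.strictMonoOn (hY : HasColumns Y lam) (T : SemistandardYoungTableau Y)
    (c : Fin n) : StrictMonoOn (fun r => T r c) (Set.Iio (lam c)) :=
  fun _ _ _ hr hlt => T.col_strict hlt (hY.mem hr)

/-- Columns increase strictly, so an entry occurs at most once in each; counting its cells is
counting columns. -/
theorem HasColumns.card_filter_entry (hY : HasColumns Y lam) (T : SemistandardYoungTableau Y)
    (i : ℕ) : (Y.cells.filter fun c => T c.1 c.2 = i).card
      = (univ.filter fun c : Fin n => ∃ r ∈ range (lam c), T r c = i).card := by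
  have hmem : ∀ a ∈ Y.cells.filter (fun c => T c.1 c.2 = i),
      ∃ h : a.2 < n, a.1 < lam ⟨a.2, h⟩ := fun a ha => (hY a.1 a.2).1 (mem_filter.1 ha).1
  refine Finset.card_bij (fun a ha => ⟨a.2, (hmem a ha).1⟩) ?_ ?_ ?_
  · intro a ha
    exact mem_filter.2 ⟨mem_univ _, a.1, mem_range.2 (hmem a ha).2, (mem_filter.1 ha).2⟩
  · intro a ha b hb hab
    have h2 : a.2 = b.2 := congrArg Fin.val hab
    obtain ⟨hc, hr⟩ := hmem a ha
    obtain ⟨hc', hr'⟩ := hmem b hb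
    have ea := (mem_filter.1 ha).2
    have eb := (mem_filter.1 hb).2
    refine Prod.ext ((hY.strictMonoOn T ⟨a.2, hc⟩).injOn hr ?_ ?_) h2
    · exact (show (⟨a.2, hc⟩ : Fin n) = ⟨b.2, hc'⟩ from Fin.ext h2) ▸ hr'
    · change T a.1 a.2 = T b.1 a.2
      rw [ea, h2, eb]
  · intro c hc
    obtain ⟨r, hr, hT⟩ := (mem_filter.1 hc).2
    exact ⟨(r, c), mem_filter.2 ⟨hY.mem (mem_range.1 hr), hT⟩, rfl⟩

theorem HasContent.entry_lt {T : SemistandardYoungTableau Y} (hT : HasContent α T) {r c : ℕ}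
    (h : (r, c) ∈ Y) : T r c < l := by
  by_contra hl
  have h1 := hT (T r c)
  rw [dif_neg hl, Finset.card_eq_zero] at h1
  exact Finset.notMem_empty _ (h1 ▸ mem_filter.2 ⟨h, rfl⟩ : (r, c) ∈ (∅ : Finset (ℕ × ℕ)))

theorem inStrip_tableauStrips (hY : HasColumns Y lam) {T : SemistandardYoungTableau Y}
    (hT : HasContent α T) (c : Fin n) (s : ℕ) :
    InStrip (tableauStrips lam l T) c s ↔ ∃ r ∈ range (lam c), T r c = s := by
  simp only [InStrip, tableauStrips, mem_filter, mem_univ, true_and]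
  refine ⟨fun h => h.2, fun h => ⟨?_, h⟩⟩
  obtain ⟨r, hr, rfl⟩ := h
  exact hT.entry_lt (hY.mem (mem_range.1 hr))

theorem stripShape_tableauStrips (hY : HasColumns Y lam) {T : SemistandardYoungTableau Y}
    (hT : HasContent α T) (t : ℕ) (c : Fin n) :
    stripShape (tableauStrips lam l T) t c = ((range (lam c)).filter fun r => T r c < t).card := by
  rw [stripShape, Nat.count_eq_card_filter_range]
  rw [← Finset.card_image_of_injOn (f := fun r => T r c)
    (s := (range (lam c)).filter fun r => T r c < t)]
  · congr 1
    ext s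
    simp only [mem_filter, mem_range, mem_image, inStrip_tableauStrips hY hT]
    constructor
    · rintro ⟨hs, r, hr, rfl⟩
      exact ⟨r, ⟨hr, hs⟩, rfl⟩
    · rintro ⟨r, ⟨hr, hs⟩, rfl⟩
      exact ⟨hs, r, hr, rfl⟩
  · intro r hr r' hr' h
    exact (hY.strictMonoOn T c).injOn (mem_range.1 (mem_filter.1 hr).1)
      (mem_range.1 (mem_filter.1 hr').1) h

theorem isStripChain_tableauStrips (hY : HasColumns Y lam) (hlam : Antitone lam)
    {T : SemistandardYoungTableau Y} (hT : HasContent α T) :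
    IsStripChain α (tableauStrips lam l T) := by
  refine ⟨fun s => ?_, fun t _ c d hcd => ?_⟩
  · rw [tableauStrips, ← hY.card_filter_entry, hT s, dif_pos s.2]
  · rw [stripShape_tableauStrips hY hT, stripShape_tableauStrips hY hT]
    refine Finset.card_le_card fun r hr => ?_
    simp only [mem_filter, mem_range] at hr ⊢
    exact ⟨hr.1.trans_le (hlam hcd), (T.row_weak_of_le hcd (hY.mem hr.1)).trans_lt hr.2⟩

theorem stripShape_tableauStrips_last (hY : HasColumns Y lam)
    {T : SemistandardYoungTableau Y} (hT : HasContent α T) :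
    stripShape (tableauStrips lam l T) l = lam := by
  ext c
  rw [stripShape_tableauStrips hY hT, Finset.filter_true_of_mem, card_range]
  exact fun r hr => hT.entry_lt (hY.mem (mem_range.1 hr))

/-- A column lists in increasing order the numbers of the strips that meet it, so the strips recover
the tableau. -/
theorem nth_inStrip_tableauStrips (hY : HasColumns Y lam)
    {T : SemistandardYoungTableau Y} (hT : HasContent α T) {c : Fin n} {r : ℕ} (hr : r < lam c) :
    Nat.nth (InStrip (tableauStrips lam l T) c) r = T r c := by
  have h1 : stripShape (tableauStrips lam l T) (T r c) c = r := by
    rw [stripShape_tableauStrips hY hT]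
    conv_rhs => rw [← card_range r]
    congr 1
    ext r'
    simp only [mem_filter, mem_range]
    constructor
    · rintro ⟨hr', h⟩
      exact ((hY.strictMonoOn T c).lt_iff_lt hr' hr).1 h
    · intro h
      exact ⟨h.trans hr, (hY.strictMonoOn T c) (h.trans hr) hr h⟩
  have h2 := Nat.nth_count (p := InStrip (tableauStrips lam l T) c) (n := T r c)
    ((inStrip_tableauStrips hY hT c _).2 ⟨r, mem_range.2 hr, rfl⟩)
  rwa [show Nat.count (InStrip (tableauStrips lam l T) c) (T r c) = r from h1] at h2

theorem card_inStrip (I : Fin l → Finset (Fin n)) (c : Fin n)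
    (hf : (Set.ofPred (InStrip I c)).Finite) : hf.toFinset.card = stripShape I l c := by
  rw [stripShape, Nat.count_eq_card_filter_range]
  congr 1
  ext s
  simp only [Set.Finite.mem_toFinset, mem_filter, mem_range]
  exact ⟨fun h => ⟨h.1, h⟩, fun h => h.2⟩

/-- The tableau with given strips of cells with equal entries. -/
noncomputable def stripTableau (hY : HasColumns Y lam) (I : Fin l → Finset (Fin n))
    (hI : ∀ t ≤ l, Antitone (stripShape I t)) (hl : stripShape I l = lam) :
    SemistandardYoungTableau Y where
  entry r c := if h : c < n then Nat.nth (InStrip I ⟨c, h⟩) r else 0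
  row_weak' {r c d} hcd hmem := by
    obtain ⟨hd, hr⟩ := (hY r d).1 hmem
    have hc : c < n := hcd.trans hd
    have hlt : ∀ hf : (Set.ofPred (InStrip I ⟨d, hd⟩)).Finite, r < hf.toFinset.card := fun hf => by
      rwa [card_inStrip, hl]
    obtain ⟨hs, -⟩ := Nat.nth_mem r hlt
    -- Up to and including its entry in row r, column d meets r + 1 strips. The shape at that time
    -- is antitone, so column c meets at least as many, and its entry in row r is no larger.
    have h1 := Nat.count_nth_succ hlt
    have h2 := hI _ (Nat.succ_le_of_lt hs) (show (⟨c, hc⟩ : Fin n) ≤ ⟨d, hd⟩ from hcd.le)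
    rw [dif_pos hc, dif_pos hd]
    refine Nat.lt_succ_iff.1 (Nat.nth_lt_of_lt_count ?_)
    change _ ≤ Nat.count _ _ at h2
    refine lt_of_lt_of_le ?_ h2
    change r < Nat.count _ _
    rw [Nat.succ_eq_add_one, h1]
    exact r.lt_succ_self
  col_strict' {r r' c} hr hmem := by
    obtain ⟨hc, hr'⟩ := (hY r' c).1 hmem
    rw [dif_pos hc, dif_pos hc]
    exact Nat.nth_lt_nth' hr fun hf => by rwa [card_inStrip, hl]
  zeros' {r c} hmem := by
    split_ifs with hc
    · have hf : (Set.ofPred (InStrip I ⟨c, hc⟩)).Finite :=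
        (Set.finite_lt_nat l).subset fun s hs => hs.1
      refine Nat.nth_of_card_le hf ?_
      rw [card_inStrip, hl]
      by_contra hlt
      exact hmem ((hY r c).2 ⟨hc, not_le.1 hlt⟩)
    · rfl

theorem exists_stripTableau_eq_iff (hY : HasColumns Y lam) {I : Fin l → Finset (Fin n)}
    (hI : ∀ t ≤ l, Antitone (stripShape I t)) (hl : stripShape I l = lam) (c : Fin n) (s : ℕ) :
    (∃ r ∈ range (lam c), stripTableau hY I hI hl r c = s) ↔ InStrip I c s := by
  have hT : ∀ r, stripTableau hY I hI hl r c = Nat.nth (InStrip I c) r := fun r => dif_pos c.2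
  simp only [hT, mem_range]
  have hf : (Set.ofPred (InStrip I c)).Finite :=
    (Set.finite_lt_nat l).subset fun s hs => hs.1
  constructor
  · rintro ⟨r, hr, rfl⟩
    exact Nat.nth_mem r fun hf => by rwa [card_inStrip, hl]
  · intro h
    obtain ⟨r, hr, h⟩ := Nat.exists_lt_card_finite_nth_eq hf h
    rw [card_inStrip, hl] at hr
    exact ⟨r, hr, h⟩

theorem hasContent_stripTableau (hY : HasColumns Y lam) {I : Fin l → Finset (Fin n)}
    (hI : IsStripChain α I) (hl : stripShape I l = lam) :
    HasContent α (stripTableau hY I hI.2 hl) := by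
  intro i
  rw [hY.card_filter_entry]
  simp only [exists_stripTableau_eq_iff]
  split_ifs with h
  · rw [← hI.1]
    congr 1
    ext c
    simp [InStrip, h]
  · rw [Finset.card_eq_zero, Finset.filter_eq_empty_iff]
    exact fun c _ hc => h hc.1

theorem tableauStrips_stripTableau (hY : HasColumns Y lam) {I : Fin l → Finset (Fin n)}
    (hI : IsStripChain α I) (hl : stripShape I l = lam) :
    tableauStrips lam l (stripTableau hY I hI.2 hl) = I := by
  ext s c
  simp only [tableauStrips, exists_stripTableau_eq_iff, mem_filter, mem_univ, true_and]
  simp [InStrip]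

-- The bijection sends a tableau to its level sets, recorded as sets of columns. Strict columns make
-- these sets lossless; weak rows amount to antitone intermediate shapes.
open Classical in
theorem kostka_transpose (lam : Fin n → ℕ) (hlam : Antitone lam) (α : Fin l → ℕ) :
    kostka (youngDiagram lam hlam).transpose α
      = (univ.filter fun I : Fin l → Finset (Fin n) =>
          IsStripChain α I ∧ stripShape I l = lam).card := by
  have hY := hasColumns_transpose_youngDiagram lam hlam
  set Y := (youngDiagram lam hlam).transpose
  rw [← Fintype.card_subtype, ← Nat.card_eq_fintype_card]
  refine Nat.card_congr (Equiv.ofBijective (α := {T : SemistandardYoungTableau Y // HasContent α T})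
    (fun T => ⟨tableauStrips lam l T.1,
      isStripChain_tableauStrips hY hlam T.2, stripShape_tableauStrips_last hY T.2⟩) ⟨?_, ?_⟩)
  · intro T T' h
    have h1 : tableauStrips lam l T.1 = tableauStrips lam l T'.1 := congrArg Subtype.val h
    refine Subtype.ext (SemistandardYoungTableau.ext fun r c => ?_)
    by_cases hmem : (r, c) ∈ Y
    · obtain ⟨hc, hr⟩ := (hY r c).1 hmem
      have e1 := nth_inStrip_tableauStrips hY T.2 hr
      have e2 := nth_inStrip_tableauStrips hY T'.2 hr
      rw [h1] at e1
      exact e1.symm.trans e2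
    · rw [T.1.zeros hmem, T'.1.zeros hmem]
  · rintro ⟨I, hI, hl⟩
    exact ⟨⟨stripTableau hY I hI.2 hl, hasContent_stripTableau hY hI hl⟩,
      Subtype.ext (tableauStrips_stripTableau hY hI hl)⟩

-- Chains are grouped by their final shape, which has at most l columns because each strip adds at
-- most one box to a row.
open Classical in
theorem sum_kostka_mul (α : Fin l → ℕ) (A : (Fin n → ℕ) → ℂ) :
    ∑ lam : BoxPartition n l, (kostka (youngDiagram lam.1 lam.2.1).transpose α : ℂ) * A lam.1
      = ∑ I : Fin l → Finset (Fin n) with IsStripChain α I, A (stripShape I l) := by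
  simp_rw [kostka_transpose, ← Finset.filter_filter, ← nsmul_eq_mul, ← Finset.sum_const]
  rw [← Finset.sum_fiberwise_of_maps_to (s := univ.filter fun I => IsStripChain α I)
    (t := univ.image fun lam : BoxPartition n l => lam.1) (g := fun I => stripShape I l)]
  · rw [Finset.sum_image Subtype.val_injective.injOn]
    refine Finset.sum_congr rfl fun lam _ => Finset.sum_congr rfl fun I hI => ?_
    rw [(mem_filter.1 hI).2]
  · intro I hI
    exact mem_image.2 ⟨⟨stripShape I l, (mem_filter.1 hI).2.2 l le_rfl, fun c => Nat.count_le _⟩,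
      mem_univ _, rfl⟩

theorem stripShape_snoc_of_le (I : Fin l → Finset (Fin n)) (J : Finset (Fin n)) {t : ℕ}
    (ht : t ≤ l) : stripShape (Fin.snoc I J : Fin (l + 1) → Finset (Fin n)) t = stripShape I t := by
  ext c
  simp only [stripShape, Nat.count_eq_card_filter_range]
  congr 1
  refine Finset.filter_congr fun s hs => ?_
  have hs' : s < l := (mem_range.1 hs).trans_le ht
  have : (Fin.snoc I J : Fin (l + 1) → Finset (Fin n)) ⟨s, hs'.trans l.lt_succ_self⟩ = I ⟨s, hs'⟩ :=
    Fin.snoc_castSucc (α := fun _ => Finset (Fin n)) J I ⟨s, hs'⟩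
  simp [InStrip, hs', this, hs'.trans l.lt_succ_self]

theorem stripShape_snoc_last (I : Fin l → Finset (Fin n)) (J : Finset (Fin n)) :
    stripShape (Fin.snoc I J : Fin (l + 1) → Finset (Fin n)) (l + 1)
      = addStrip (stripShape I l) J := by
  ext c
  have h := congrFun (stripShape_snoc_of_le I J le_rfl) c
  simp only [stripShape, addStrip] at h ⊢
  rw [Nat.count_succ, h]
  have h1 : InStrip (Fin.snoc I J : Fin (l + 1) → Finset (Fin n)) c l ↔ c ∈ J := by
    have : (Fin.snoc I J : Fin (l + 1) → Finset (Fin n)) ⟨l, l.lt_succ_self⟩ = J :=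
      Fin.snoc_last (α := fun _ => Finset (Fin n)) J I
    simp [InStrip, this]
  simp only [h1]

theorem isStripChain_snoc (α : Fin (l + 1) → ℕ) (I : Fin l → Finset (Fin n))
    (J : Finset (Fin n)) : IsStripChain α (Fin.snoc I J : Fin (l + 1) → Finset (Fin n)) ↔
      IsStripChain (fun i => α i.castSucc) I ∧ J.card = α (Fin.last l) ∧
        Antitone (addStrip (stripShape I l) J) := by
  unfold IsStripChain
  rw [Fin.forall_fin_succ']
  simp only [Fin.snoc_castSucc, Fin.snoc_last]
  constructor
  · rintro ⟨⟨h1, h2⟩, h3⟩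
    exact ⟨⟨h1, fun t ht => stripShape_snoc_of_le I J ht ▸ h3 t (ht.trans l.le_succ)⟩, h2,
      stripShape_snoc_last I J ▸ h3 (l + 1) le_rfl⟩
  · rintro ⟨⟨h1, h3⟩, h2, h4⟩
    refine ⟨⟨h1, h2⟩, fun t ht => ?_⟩
    obtain ht | rfl := Nat.le_succ_iff.1 ht
    · exact stripShape_snoc_of_le I J ht ▸ h3 t ht
    · exact stripShape_snoc_last I J ▸ h4

-- Iterated Pieri rule: at each step the additions that break monotonicity have vanishing alternant,
-- so exactly the strip chains survive. Divided by the Vandermonde factor, this is e_α = ∑ K_{λ^t α}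
-- s_λ.
open Classical in
theorem prod_elementarySymm_mul_alternant (α : Fin l → ℕ) {x : Fin n → ℂ} (hx : ∀ i, x i ≠ 0) :
    (∏ i, elementarySymm (α i) x) * alternant x (bead fun _ => 0)
      = ∑ I : Fin l → Finset (Fin n) with IsStripChain α I,
          alternant x (bead (stripShape I l)) := by
  induction l with
  | zero =>
    have h : ∀ I : Fin 0 → Finset (Fin n), stripShape I 0 = fun _ => 0 := fun I => by
      ext c; simp [stripShape]
    have h' : ∀ I : Fin 0 → Finset (Fin n), IsStripChain α I := fun I =>
      ⟨fun s => s.elim0, fun t ht => by rw [Nat.le_zero.1 ht, h]; exact antitone_const⟩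
    simp [h, h']
  | succ l ih =>
    rw [Fin.prod_univ_castSucc, mul_right_comm, ih, Finset.sum_mul, Finset.sum_filter,
      Finset.sum_filter, ← Equiv.sum_comp (Fin.snocEquiv fun _ => Finset (Fin n)),
      Fintype.sum_prod_type_right]
    refine Finset.sum_congr rfl fun I _ => ?_
    change _ = ∑ J, if IsStripChain α (Fin.snoc I J : Fin (l + 1) → Finset (Fin n)) then
      alternant x (bead (stripShape (Fin.snoc I J : Fin (l + 1) → Finset (Fin n)) (l + 1))) else 0
    simp only [isStripChain_snoc, stripShape_snoc_last]
    by_cases hI : IsStripChain (fun i => α i.castSucc) I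
    · simp only [hI, true_and, if_true]
      rw [mul_comm, elementarySymm_mul_alternant_bead _ hx, ← Finset.sum_filter]
      symm
      refine Finset.sum_subset_zero_on_sdiff (fun J hJ => ?_) (fun J hJ => ?_) fun J _ => rfl
      · exact mem_powersetCard.2 ⟨subset_univ _, (mem_filter.1 hJ).2.1⟩
      · rw [mem_sdiff, mem_filter, mem_powersetCard] at hJ
        exact alternant_bead_addStrip_eq_zero (hI.2 l le_rfl)
          (fun h => hJ.2 ⟨mem_univ _, hJ.1.2, h⟩) x
    · simp [hI]

end Kostka

/-- Both sides are sums over σ of S_{μσ} S_{ν*σ} times ∏ e_{α_i}, which is left as a product on the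
path side and expanded over strip chains on the other. -/
theorem sum_paths_eq_sum_kostka_mul_verlindeSum {n k : ℕ} [NeZero n] {l : ℕ} (α : Fin l → ℕ)
    (hα : ∀ i, α i ≤ n) (j : Fin l → ZMod n) (μ ν : AffineWeight n k) :
    ∑ S : Fin (l + 1) → AffineWeight n k with S 0 = ν ∧ S (Fin.last l) = μ,
        ∏ i : Fin l, fusionCoeff (AffineWeight.ofColumn (α i) (Nat.le_add_left 1 k))
          (AffineWeight.create (j i) (S i.succ)) (AffineWeight.create (j i) (S i.castSucc))
      = ∑ lam : BoxPartition n l, (kostka (youngDiagram lam.1 lam.2.1).transpose α : ℂ) *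
          verlindeSum lam.1 μ ν := by
  classical
  have h : ∀ σ : AffineWeight n k, ∑ I : Fin l → Finset (Fin n) with IsStripChain α I,
      modularS k (stripShape I l) σ.toPartition
      = (∏ i, elementarySymm (α i) σ.point) * modularS k (fun _ => 0) σ.toPartition := by
    intro σ
    simp_rw [modularS_eq_point]
    rw [← Finset.mul_sum, ← prod_elementarySymm_mul_alternant α σ.point_ne_zero, mul_left_comm]
  rw [sum_paths_fusionCoeff α hα, sum_kostka_mul α fun lam => verlindeSum lam μ ν]
  unfold verlindeSum
  rw [Finset.sum_comm]
  refine Finset.sum_congr rfl fun σ _ => ?_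
  rw [← Finset.sum_div, eq_div_iff (modularS_zero_ne_zero σ), ← Finset.sum_mul, ← Finset.sum_mul,
    h]
  ring

end SlFusion

theorem mainTheorem11 (n k : ℕ) [NeZero n] (hk : 1 ≤ k) :
    -- the recursion relation, with all weights on the right-hand side of level `k`
    (∀ (l : ℕ), l ≤ k + 1 → ∀ (α : Fin l → ℕ), (∀ i, α i ≤ n) →
      ∀ (j : Fin l → ZMod n) (mu nu : SlFusion.AffineWeight n k),
        ∑ S : Fin (l + 1) → SlFusion.AffineWeight n k with S 0 = nu ∧ S (Fin.last l) = mu,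
            ∏ i : Fin l,
              SlFusion.fusionCoeff
                (SlFusion.AffineWeight.ofColumn (α i) (Nat.le_add_left 1 k))
                (SlFusion.AffineWeight.create (j i) (S i.succ))
                (SlFusion.AffineWeight.create (j i) (S i.castSucc))
          = ∑ lam : SlFusion.BoxPartition n l,
              (SlFusion.kostka (SlFusion.youngDiagram lam.1 lam.2.1).transpose α : ℂ) *
                (if h : SlFusion.removeColumns lam.1 0 ≤ k then
                  SlFusion.fusionCoeff (SlFusion.AffineWeight.ofPartition lam.1 lam.2.1 h) mu nu
                else 0)) ∧
    -- the recursion relation for every `l`, with the Verlinde sum of a partition of any width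
    (∀ (l : ℕ) (α : Fin l → ℕ), (∀ i, α i ≤ n) →
      ∀ (j : Fin l → ZMod n) (mu nu : SlFusion.AffineWeight n k),
        ∑ S : Fin (l + 1) → SlFusion.AffineWeight n k with S 0 = nu ∧ S (Fin.last l) = mu,
            ∏ i : Fin l,
              SlFusion.fusionCoeff
                (SlFusion.AffineWeight.ofColumn (α i) (Nat.le_add_left 1 k))
                (SlFusion.AffineWeight.create (j i) (S i.succ))
                (SlFusion.AffineWeight.create (j i) (S i.castSucc))
          = ∑ lam : SlFusion.BoxPartition n l,
              (SlFusion.kostka (SlFusion.youngDiagram lam.1 lam.2.1).transpose α : ℂ) *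
                SlFusion.verlindeSum (SlFusion.removeColumns lam.1) mu nu) ∧
    -- the case of a single column
    (∀ (r : ℕ), r ≤ n → ∀ (j : ZMod n) (mu nu : SlFusion.AffineWeight n k),
      SlFusion.fusionCoeff
          (SlFusion.AffineWeight.ofColumn r (Nat.le_add_left 1 k))
          (SlFusion.AffineWeight.create j mu) (SlFusion.AffineWeight.create j nu)
        = SlFusion.fusionCoeff (SlFusion.AffineWeight.ofColumn r hk) mu nu) := by
  refine ⟨fun l hl α hα j mu nu => ?_, fun l α hα j mu nu => ?_, fun r hr j mu nu => ?_⟩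
  · rw [SlFusion.sum_paths_eq_sum_kostka_mul_verlindeSum α hα]
    refine Finset.sum_congr rfl fun lam _ => ?_
    split_ifs with h
    · rw [SlFusion.fusionCoeff_ofPartition]
    · have h1 : SlFusion.removeColumns lam.1 0 ≤ l := (Nat.sub_le _ _).trans (lam.2.2 0)
      rw [SlFusion.verlindeSum_eq_zero (by omega)]
  · rw [SlFusion.sum_paths_eq_sum_kostka_mul_verlindeSum α hα]
    refine Finset.sum_congr rfl fun lam _ => ?_
    rw [SlFusion.verlindeSum_removeColumns lam.2.1]
  · rw [SlFusion.fusionCoeff_ofColumn _ hr, SlFusion.fusionCoeff_ofColumn _ hr,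
      SlFusion.hopCount_create]
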